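/- Let $d\ge 1$. A *phase space* is a non-empty compact set $X\subset\mathbb R^d$ with $\overline{\operatorname{int}X}=X$ which is convex, or has a smooth ($C^1$ suffices) boundary, or satisfies the cone condition (every $x\in\partial X$ is the vertex of an open cone contained in $\operatorname{int}X$, with height and opening angle independent of $x$). A *non-autonomous conformal iterated function system* (NCIFS) $\Phi$ on $X$ is a sequence $\Phi^{(n)}=(\varphi^{(n)}_i:X\to X)_{i\in I^{(n)}}$, $n\ge1$, with non-empty finite or countable index sets $I^{(n)}$, such that: * $\varphi^{(n)}_a(\operatorname{int}X)\cap\varphi^{(n)}_b(\operatorname{int}X)=\emptyset$ for all $n$ and all distinct $a,b\in I^{(n)}$; * there is an open connected $V\supset X$ such that every $\varphi^{(n)}_i$ extends to a $C^1$ conformal diffeomorphism of $V$ into $V$ (conformal: every differential is a similarity, possibly orientation-reversing); * there is $K\ge1$ with $\|D\varphi(x)\|\le K\|D\varphi(y)\|$ for all $x,y\in V$ and all compositions $\varphi=\varphi^{(k)}_{\omega_k}\circ\dots\circ\varphi^{(l)}_{\omega_l}$, $k\le l$, $\omega_j\in I^{(j)}$; * there is $\eta\in(0,1)$ such that, for all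 sufficiently large $m$, $\|D\varphi(x)\|\le\eta^m$ for all $x\in X$, all $j\ge1$ and all $\varphi=\varphi^{(j)}_{\omega_j}\circ\dots\circ\varphi^{(j+m)}_{\omega_{j+m}}$, $\omega_k\in I^{(k)}$. Write $I^n=\prod_{j=1}^nI^{(j)}$, $\varphi_\omega=\varphi^{(1)}_{\omega_1}\circ\dots\circ\varphi^{(n)}_{\omega_n}$ for $\omega\in I^n$, and $\|D\varphi\|=\sup_{x\in X}\|D\varphi(x)\|$. The limit set is $J(\Phi)=\bigcap_{n\ge1}\bigcup_{\omega\in I^n}\varphi_\omega(X)$, and the Bowen dimension is $$B(\Phi)=\sup\Bigl\{t\ge0:\ \liminf_{n\to\infty}\tfrac1n\log\sum_{\omega\in I^n}\|D\varphi_\omega\|^t>0\Bigr\},\qquad\sup\emptyset=0.$$ $\Phi$ is *finite* if every $I^{(n)}$ is finite, and *perfectly balanced* if all $\varphi^{(n)}_i$ are affine similarities and $\|D\varphi^{(n)}_a\|=\|D\varphi^{(n)}_b\|$ for all $n$ and all $a,b\in I^{(n)}$. $\operatorname{HD}$ denotes Hausdorff dimension. **Theorem.** (1) Let $\Phi$ be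 a finite NCIFS on a phase space $X\subset\mathbb R^d$ of sub-exponential growth, $\lim_{n\to\infty}\frac1n\log\#I^{(n)}=0$. Then Bowen's formula holds: $\operatorname{HD}(J(\Phi))=B(\Phi)$. (2) Let $0<t_1<t_2<d$ and $\varepsilon>0$. Then on every convex phase space $X\subset\mathbb R^d$ (for instance $X=[0,1]^d$) there is a finite, perfectly balanced NCIFS $\Phi$ with $\limsup_{n\to\infty}\frac1n\log\#I^{(n)}\le\varepsilon$, $\operatorname{HD}(J(\Phi))=t_1$ and $B(\Phi)=t_2$. -/

import Mathlib

open Set Filter Topology MeasureTheory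
open scoped ENNReal NNReal

noncomputable section

/-- Euclidean space `ℝ^d`. -/
abbrev Euc (d : ℕ) : Type := EuclideanSpace ℝ (Fin d)

/-- The boundary of the closed set `X` is a hypersurface of class `C¹`: near each boundary point,
`X` is the sublevel set of a `C¹` function with non-vanishing differential. -/
def HasC1Boundary {d : ℕ} (X : Set (Euc d)) : Prop :=
  ∀ p ∈ frontier X, ∃ (U : Set (Euc d)) (f : Euc d → ℝ), IsOpen U ∧ p ∈ U ∧
    ContDiffOn ℝ 1 f U ∧ fderiv ℝ f p ≠ 0 ∧ X ∩ U = {x ∈ U | f x ≤ 0}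

/-- The open truncated cone with vertex `x`, axis direction `u` (a unit vector), height `l`, and
half-angle `arccos c`. -/
def openCone {d : ℕ} (x u : Euc d) (c l : ℝ) : Set (Euc d) :=
  {y | y ≠ x ∧ ‖y - x‖ < l ∧ c * ‖y - x‖ < inner ℝ u (y - x)}

/-- Cone condition: every boundary point of `X` is the vertex of an open cone contained in the
interior of `X`, with height and opening angle independent of the point. -/
def ConeCondition {d : ℕ} (X : Set (Euc d)) : Prop :=
  ∃ c l : ℝ, 0 < c ∧ c < 1 ∧ 0 < l ∧
    ∀ x ∈ frontier X, ∃ u : Euc d, ‖u‖ = 1 ∧ openCone x u c l ⊆ interior X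

/-- The admissible phase spaces: non-empty compact sets which are the closure of their interior
and which are convex, or have a `C¹` boundary, or satisfy the cone condition. -/
structure IsPhaseSpace {d : ℕ} (X : Set (Euc d)) : Prop where
  nonempty : X.Nonempty
  isCompact : IsCompact X
  closure_interior : closure (interior X) = X
  geometry : Convex ℝ X ∨ HasC1Boundary X ∨ ConeCondition X

/-- For a family of maps `φ n i`, `i ∈ I n`, and a word `ω` of length `n` whose letters belong to
`I k, I (k+1), …, I (k+n-1)`, the composition `φ_{ω_0} ∘ φ_{ω_1} ∘ ⋯ ∘ φ_{ω_{n-1}}`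
(the identity for the empty word). -/
def wordMap {d : ℕ} {I : ℕ → Type} (φ : ∀ n, I n → Euc d → Euc d) (k : ℕ) :
    ∀ n : ℕ, (∀ j : Fin n, I (j + k)) → Euc d → Euc d
  | 0, _ => id
  | n + 1, ω => wordMap φ k n (fun j => ω j.castSucc) ∘ φ (n + k) (ω (Fin.last n))

/-- A non-autonomous conformal iterated function system on `X ⊆ ℝ^d`. The stages
are numbered from `0`, so that `I n` and `φ n` are the objects called `I^{(n+1)}` and `Φ^{(n+1)}`
when they are numbered from `1`. The maps `φ n i : X → X` come with their extensions to `V`; the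
values of `φ n i` outside `V` are irrelevant. -/
structure NCIFS {d : ℕ} (X : Set (Euc d)) where
  /-- the alphabets -/
  I : ℕ → Type
  countable : ∀ n, Countable (I n)
  nonempty : ∀ n, Nonempty (I n)
  /-- the maps -/
  φ : ∀ n, I n → Euc d → Euc d
  mapsTo : ∀ n i, MapsTo (φ n i) X X
  /-- open set condition -/
  openSet : ∀ n a b, a ≠ b → Disjoint (φ n a '' interior X) (φ n b '' interior X)
  /-- the common domain of the conformal extensions -/
  V : Set (Euc d)
  isOpen_V : IsOpen V
  isConnected_V : IsConnected V
  subset_V : X ⊆ V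
  /-- Conformality: each map is a `C¹` conformal diffeomorphism of `V` into `V`; the inverse is
  automatically `C¹`, since the differentials are invertible. -/
  mapsTo_V : ∀ n i, MapsTo (φ n i) V V
  injOn_V : ∀ n i, InjOn (φ n i) V
  contDiffOn_V : ∀ n i, ContDiffOn ℝ 1 (φ n i) V
  conformalAt_V : ∀ n i, ∀ x ∈ V, ConformalAt (φ n i) x
  /-- bounded distortion -/
  distortion : ∃ K : ℝ, 1 ≤ K ∧ ∀ (k n : ℕ) (ω : ∀ j : Fin n, I (j + k)), ∀ x ∈ V, ∀ y ∈ V,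
    ‖fderiv ℝ (wordMap φ k n ω) x‖ ≤ K * ‖fderiv ℝ (wordMap φ k n ω) y‖
  /-- uniform contraction -/
  contraction : ∃ η : ℝ, 0 < η ∧ η < 1 ∧ ∃ m₀ : ℕ, ∀ m ≥ m₀, ∀ (k : ℕ)
    (ω : ∀ j : Fin (m + 1), I (j + k)), ∀ x ∈ X, ‖fderiv ℝ (wordMap φ k (m + 1) ω) x‖ ≤ η ^ m

namespace NCIFS

variable {d : ℕ} {X : Set (Euc d)}

/-- Initial words of length `n`. -/
abbrev Word (Φ : NCIFS X) (n : ℕ) : Type := ∀ j : Fin n, Φ.I (j + 0)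

/-- The map `φ_ω` of an initial word `ω`. -/
def map (Φ : NCIFS X) {n : ℕ} (ω : Φ.Word n) : Euc d → Euc d := wordMap Φ.φ 0 n ω

/-- The limit set `J(Φ) = ⋂_{n ≥ 1} ⋃_{ω ∈ I^n} φ_ω(X)`. -/
def limitSet (Φ : NCIFS X) : Set (Euc d) := ⋂ n : ℕ, ⋃ ω : Φ.Word (n + 1), Φ.map ω '' X

end NCIFS

/-- `‖Df‖ = sup_{x ∈ X} ‖Df(x)‖`; for conformal `f` the operator norm of `Df(x)` is the scaling
factor of the similarity `Df(x)`. -/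
def derivNorm {d : ℕ} (X : Set (Euc d)) (f : Euc d → Euc d) : ℝ≥0∞ := ⨆ x ∈ X, ‖fderiv ℝ f x‖ₑ

namespace NCIFS

variable {d : ℕ} {X : Set (Euc d)}

/-- `Z_n(t) = ∑_{ω ∈ I^n} ‖Dφ_ω‖^t`. -/
def Z (Φ : NCIFS X) (n : ℕ) (t : ℝ≥0) : ℝ≥0∞ := ∑' ω : Φ.Word n, derivNorm X (Φ.map ω) ^ (t : ℝ)

/-- The lower pressure `liminf (1/n) log Z_n(t)`, with values in `[-∞, ∞]`. -/
def lowerPressure (Φ : NCIFS X) (t : ℝ≥0) : EReal :=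
  liminf (fun n : ℕ => ENNReal.log (Φ.Z n t) / (n : EReal)) atTop

/-- The Bowen dimension `sup {t ≥ 0 : P(t) > 0}`, where `P` is the lower pressure and the supremum
of the empty set is `0`. -/
def bowenDim (Φ : NCIFS X) : ℝ≥0∞ := ⨆ (t : ℝ≥0) (_ : 0 < Φ.lowerPressure t), (t : ℝ≥0∞)

/-- All alphabets are finite. -/
def IsFinite (Φ : NCIFS X) : Prop := ∀ n, Finite (Φ.I n)

/-- The sequence `(1/n) log #I^{(n)}`, `n ≥ 1`, with `n` written as `n + 1`. Only used for finite
systems. -/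
def growth (Φ : NCIFS X) (n : ℕ) : ℝ := Real.log (Nat.card (Φ.I n)) / ((n : ℝ) + 1)

/-- `ρ = sup_{a,b} ‖Dφ_a‖ / ‖Dφ_b‖` at a given stage. -/
def rho (Φ : NCIFS X) (n : ℕ) : ℝ≥0∞ :=
  ⨆ (a : Φ.I n) (b : Φ.I n), derivNorm X (Φ.φ n a) / derivNorm X (Φ.φ n b)

/-- Perfectly balanced systems: `ρ = 1` at all stages, and all maps are affine similarities. -/
def PerfectlyBalanced (Φ : NCIFS X) : Prop :=
  (∀ n, Φ.rho n = 1) ∧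
  ∀ n i, ∃ (r : ℝ) (L : Euc d ≃ₗᵢ[ℝ] Euc d) (b : Euc d), 0 < r ∧
    ∀ x ∈ X, Φ.φ n i x = r • L x + b

end NCIFS

end

/-! Upper bound in (1): if the lower pressure at `t` is not positive and `s > t`, then for
infinitely many `n` uniform contraction keeps `∑ ‖Dφ_ω‖^s` over words of length `n` below a fixed
constant. The images of `X`, cut into boundedly many pieces, are covers with bounded `s`-sums, so
`HD ≤ s`.

Lower bound: give a word `ω` of length `n` the mass `‖Dφ_ω‖^t / Z_n(t)`. Exchanging prefixes bounds
the mass of the cylinder of a word `τ` of length `k` by `K^t ‖Dφ_τ‖^t / Z_k(t)`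
(`tsum_cylinder_mul_Z_le`). Given a ball of radius `r`, stop each word when its derivative norm
first falls below `r`, say after `k + 1` letters. The prefix of length `k` has norm at least `r` and
its image meets the ball, so a volume count leaves at most `M` such prefixes (`exists_card_le`). The
mass of the ball is then at most `M K^t r^t` times the sum over `k` of (size of the alphabet of the
last letter) / `Z_{k+1}(t)`, which converges when the pressure is positive and the alphabets grow
sub-exponentially. `le_dimH_limitSet_of_weights` turns this into `HD ≥ t`.

For (2), take homotheties that branch only at sparse stages, along a geometric progression. Let `N`
be the number of words and `ρ` their common ratio. Just before each branching `N ρ^t₂` equals a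
fixed constant, and at all other times it is at least that constant (`W_stage`, `le_S`); hence the
Bowen dimension is `t₂`. At a branching stage the new images are crowded into a cluster much smaller
than their parent, of size comparable to `N^(-1/t₁)`. Covering by the `N` clusters gives `HD ≤ t₁`;
inside a cluster the images form a regular `d`-dimensional grid, so balls of intermediate radius
carry no excess mass and `HD ≥ t₁`. There is room to crowd without overlap because `1/t₂ > 1/d` and
earlier branchings are negligible when the progression is sparse enough (`exp_neg_logRatio_le`). -/

noncomputable section

namespace NCIFS

variable {d : ℕ} {X : Set (Euc d)}

/-! ### Conformal linear maps: norm and determinant -/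

section Conformal

/-- A conformal linear map is a multiple of an isometry, so the chain rule becomes an exact product
of norms. -/
theorem isConformalMap_enorm_comp [Nontrivial (Euc d)] {f g : Euc d →L[ℝ] Euc d}
    (hf : IsConformalMap f) : ‖f.comp g‖ₑ = ‖f‖ₑ * ‖g‖ₑ := by
  obtain ⟨c, -, L, rfl⟩ := hf
  have h1 : ‖(c • L.toContinuousLinearMap).comp g‖ = ‖c‖ * ‖g‖ := by
    rw [ContinuousLinearMap.smul_comp, norm_smul, LinearIsometry.norm_toContinuousLinearMap_comp]
  have h2 : ‖c • L.toContinuousLinearMap‖ = ‖c‖ := by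
    rw [norm_smul, LinearIsometry.norm_toContinuousLinearMap, mul_one]
  rw [← ofReal_norm, ← ofReal_norm, ← ofReal_norm, h1, h2, ENNReal.ofReal_mul (norm_nonneg _)]

theorem isConformalMap_enorm_ne_zero [Nontrivial (Euc d)] {f : Euc d →L[ℝ] Euc d}
    (hf : IsConformalMap f) : ‖f‖ₑ ≠ 0 := by
  rw [← ofReal_norm, ne_eq, ENNReal.ofReal_eq_zero, not_le]
  exact norm_pos_iff.2 hf.ne_zero

/-- A linear isometry preserves the volume of the unit ball, hence has determinant `±1`. This
converts derivative norms into Jacobians. -/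
theorem isConformalMap_abs_det {f : Euc d →L[ℝ] Euc d} (hd : 0 < d)
    (hf : IsConformalMap f) : ENNReal.ofReal |f.det| = ‖f‖ₑ ^ d := by
  have : Nonempty (Fin d) := ⟨⟨0, hd⟩⟩
  obtain ⟨c, -, L, rfl⟩ := hf
  have h2 : ‖c • L.toContinuousLinearMap‖ = |c| := by
    rw [norm_smul, LinearIsometry.norm_toContinuousLinearMap, mul_one, Real.norm_eq_abs]
  have hL : |LinearMap.det (L.toLinearMap)| = 1 := by
    have h := L.normDet_eq_one
    have hv := Measure.addHaar_image_linearMap (volume : Measure (Euc d)) L.toLinearMap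
      (Metric.ball 0 1)
    have hi := (LinearIsometry.toLinearIsometryEquiv L rfl).measurePreserving
    have him : (L.toLinearMap : Euc d → Euc d) '' (Metric.ball 0 1) = Metric.ball 0 1 := by
      have := (LinearIsometry.toLinearIsometryEquiv L rfl).image_ball 0 1
      simpa using this
    rw [him] at hv
    have hpos : volume (Metric.ball (0 : Euc d) 1) ≠ 0 := (Metric.measure_ball_pos _ _ one_pos).ne'
    have hfin : volume (Metric.ball (0 : Euc d) 1) ≠ ⊤ := measure_ball_lt_top.ne
    have h3 : ENNReal.ofReal |LinearMap.det L.toLinearMap| = 1 := by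
      rw [← ENNReal.mul_left_inj hpos hfin, one_mul]; exact hv.symm
    rwa [ENNReal.ofReal_eq_one] at h3
  have hdet : (c • L.toContinuousLinearMap).det = c ^ d * LinearMap.det L.toLinearMap := by
    have : (c • L.toContinuousLinearMap).det = LinearMap.det (c • L.toLinearMap) := rfl
    rw [this, LinearMap.det_smul]; simp
  rw [hdet, abs_mul, hL, mul_one, ← ofReal_norm, h2, abs_pow, ENNReal.ofReal_pow (abs_nonneg _)]

end Conformal

/-! ### Compositions along words and the open set condition -/

section WordMap

variable (Φ : NCIFS X)

theorem wordMap_mapsTo (k n : ℕ) (ω : ∀ j : Fin n, Φ.I (j + k)) :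
    MapsTo (wordMap Φ.φ k n ω) X X := by
  induction n with
  | zero => exact mapsTo_id _
  | succ n ih => exact (ih _).comp (Φ.mapsTo _ _)

theorem wordMap_mapsTo_V (k n : ℕ) (ω : ∀ j : Fin n, Φ.I (j + k)) :
    MapsTo (wordMap Φ.φ k n ω) Φ.V Φ.V := by
  induction n with
  | zero => exact mapsTo_id _
  | succ n ih => exact (ih _).comp (Φ.mapsTo_V _ _)

theorem wordMap_injOn (k n : ℕ) (ω : ∀ j : Fin n, Φ.I (j + k)) :
    InjOn (wordMap Φ.φ k n ω) Φ.V := by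
  induction n with
  | zero => exact injOn_id _
  | succ n ih => exact (ih _).comp (Φ.injOn_V _ _) (Φ.mapsTo_V _ _)

theorem wordMap_contDiffOn (k n : ℕ) (ω : ∀ j : Fin n, Φ.I (j + k)) :
    ContDiffOn ℝ 1 (wordMap Φ.φ k n ω) Φ.V := by
  induction n with
  | zero => exact contDiffOn_id
  | succ n ih => exact (ih _).comp (Φ.contDiffOn_V _ _) (Φ.mapsTo_V _ _)

theorem wordMap_conformalAt (k n : ℕ) (ω : ∀ j : Fin n, Φ.I (j + k)) {x : Euc d} (hx : x ∈ Φ.V) :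
    ConformalAt (wordMap Φ.φ k n ω) x := by
  induction n generalizing x with
  | zero => exact conformalAt_id x
  | succ n ih => exact (ih _ (Φ.mapsTo_V _ _ hx)).comp x (Φ.conformalAt_V _ _ x hx)

/-- The composition of `n` maps starting at stage `k`, the letters being read off from `ω`. -/
def seqMap (ω : ∀ j, Φ.I j) (k n : ℕ) : Euc d → Euc d := wordMap Φ.φ k n fun j => ω (j + k)

@[simp] theorem seqMap_zero (ω : ∀ j, Φ.I j) (k : ℕ) : Φ.seqMap ω k 0 = id := rfl

theorem seqMap_succ (ω : ∀ j, Φ.I j) (k n : ℕ) :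
    Φ.seqMap ω k (n + 1) = Φ.seqMap ω k n ∘ Φ.φ (n + k) (ω (n + k)) := rfl

theorem seqMap_congr {ω ω' : ∀ j, Φ.I j} {k n : ℕ} (h : ∀ j, k ≤ j → j < k + n → ω j = ω' j) :
    Φ.seqMap ω k n = Φ.seqMap ω' k n := by
  unfold seqMap
  congr 1
  funext j
  exact h _ (by omega) (by omega)

theorem seqMap_add (ω : ∀ j, Φ.I j) (k n m : ℕ) :
    Φ.seqMap ω k (n + m) = Φ.seqMap ω k n ∘ Φ.seqMap ω (k + n) m := by
  induction m with
  | zero => rfl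
  | succ m ih =>
    rw [← add_assoc, seqMap_succ, seqMap_succ, ih, Function.comp_assoc,
      show n + m + k = m + (k + n) by omega]

theorem seqMap_mapsTo (ω : ∀ j, Φ.I j) (k n : ℕ) : MapsTo (Φ.seqMap ω k n) X X :=
  Φ.wordMap_mapsTo k n _

theorem seqMap_mapsTo_V (ω : ∀ j, Φ.I j) (k n : ℕ) : MapsTo (Φ.seqMap ω k n) Φ.V Φ.V :=
  Φ.wordMap_mapsTo_V k n _

theorem seqMap_injOn (ω : ∀ j, Φ.I j) (k n : ℕ) : InjOn (Φ.seqMap ω k n) Φ.V :=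
  Φ.wordMap_injOn k n _

theorem seqMap_contDiffOn (ω : ∀ j, Φ.I j) (k n : ℕ) : ContDiffOn ℝ 1 (Φ.seqMap ω k n) Φ.V :=
  Φ.wordMap_contDiffOn k n _

theorem seqMap_continuousOn (ω : ∀ j, Φ.I j) (k n : ℕ) : ContinuousOn (Φ.seqMap ω k n) X :=
  (Φ.seqMap_contDiffOn ω k n).continuousOn.mono Φ.subset_V

theorem seqMap_differentiableAt (ω : ∀ j, Φ.I j) (k n : ℕ) {x : Euc d} (hx : x ∈ Φ.V) :
    DifferentiableAt ℝ (Φ.seqMap ω k n) x :=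
  ((Φ.seqMap_contDiffOn ω k n).differentiableOn one_ne_zero).differentiableAt
    (Φ.isOpen_V.mem_nhds hx)

theorem seqMap_isConformalMap (ω : ∀ j, Φ.I j) (k n : ℕ) {x : Euc d} (hx : x ∈ Φ.V) :
    IsConformalMap (fderiv ℝ (Φ.seqMap ω k n) x) :=
  conformalAt_iff_isConformalMap_fderiv.1 (Φ.wordMap_conformalAt k n _ hx)

theorem isOpen_image_interior (n : ℕ) (i : Φ.I n) : IsOpen (Φ.φ n i '' interior X) := by
  rw [isOpen_iff_mem_nhds]
  rintro _ ⟨x, hx, rfl⟩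
  have hxV : x ∈ Φ.V := Φ.subset_V (interior_subset hx)
  have hs : HasStrictFDerivAt (Φ.φ n i) (fderiv ℝ (Φ.φ n i) x) x :=
    ((Φ.contDiffOn_V n i).contDiffAt (Φ.isOpen_V.mem_nhds hxV)).hasStrictFDerivAt one_ne_zero
  have hc := conformalAt_iff_isConformalMap_fderiv.1 (Φ.conformalAt_V n i x hxV)
  have hsurj : (fderiv ℝ (Φ.φ n i) x).range = ⊤ := by
    apply LinearMap.range_eq_top.2
    exact LinearMap.surjective_of_injective (f := (fderiv ℝ (Φ.φ n i) x).toLinearMap) hc.injective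
  rw [← hs.map_nhds_eq_of_surj hsurj]
  exact image_mem_map (isOpen_interior.mem_nhds hx)

/-- Invertible differentials make the maps open, so the image of the interior is an open subset of
`X`. -/
theorem mapsTo_interior (n : ℕ) (i : Φ.I n) : MapsTo (Φ.φ n i) (interior X) (interior X) := by
  rw [mapsTo_iff_image_subset]
  exact interior_maximal ((image_mono interior_subset).trans (Φ.mapsTo n i).image_subset)
    (Φ.isOpen_image_interior n i)

/-- If the prefixes already differ, disjointness is inherited because the last maps preserve the
interior; otherwise the last letters differ, and the common injective prefix transports the open set
condition. -/
theorem seqMap_disjoint {ω ω' : ∀ j, Φ.I j} {n : ℕ} (h : ∃ j < n, ω j ≠ ω' j) :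
    Disjoint (Φ.seqMap ω 0 n '' interior X) (Φ.seqMap ω' 0 n '' interior X) := by
  induction n with
  | zero => obtain ⟨j, hj, -⟩ := h; omega
  | succ n ih =>
    rw [seqMap_succ, seqMap_succ, image_comp, image_comp]
    by_cases hn : ∃ j < n, ω j ≠ ω' j
    · exact (ih hn).mono (image_mono (Φ.mapsTo_interior _ _).image_subset)
        (image_mono (Φ.mapsTo_interior _ _).image_subset)
    · push Not at hn
      obtain ⟨j, hj, hne⟩ := h
      obtain rfl : j = n := by
        by_contra hjn
        exact hne (hn j (by omega))
      rw [Φ.seqMap_congr (ω := ω) (ω' := ω') fun i _ hi => hn i (by omega)]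
      have hsub : ∀ i, Φ.φ (j + 0) i '' interior X ⊆ Φ.V := fun i =>
        (Φ.mapsTo_interior _ _).image_subset.trans (interior_subset.trans Φ.subset_V)
      rw [Set.disjoint_iff_inter_eq_empty, ← (Φ.seqMap_injOn ω' 0 j).image_inter (hsub _) (hsub _),
        (Φ.openSet (j + 0) (ω (j + 0)) (ω' (j + 0)) hne).inter_eq, image_empty]

end WordMap

/-! ### Bounded distortion and quasi-multiplicativity of derivative norms -/

section DerivNorm

theorem enorm_fderiv_le_derivNorm {f : Euc d → Euc d} {x : Euc d} (hx : x ∈ X) :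
    ‖fderiv ℝ f x‖ₑ ≤ derivNorm X f :=
  le_iSup₂ (f := fun x (_ : x ∈ X) => ‖fderiv ℝ f x‖ₑ) x hx

variable (Φ : NCIFS X)

theorem exists_distortion : ∃ K : ℝ≥0, 1 ≤ K ∧ ∀ (ω : ∀ j, Φ.I j) (k n : ℕ), ∀ x ∈ Φ.V, ∀ y ∈ Φ.V,
    ‖fderiv ℝ (Φ.seqMap ω k n) x‖ₑ ≤ K * ‖fderiv ℝ (Φ.seqMap ω k n) y‖ₑ := by
  obtain ⟨K, hK, h⟩ := Φ.distortion
  lift K to ℝ≥0 using by linarith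
  refine ⟨K, hK, fun ω k n x hx y hy => ?_⟩
  rw [← ofReal_norm, ← ofReal_norm, ← ENNReal.ofReal_coe_nnreal,
    ← ENNReal.ofReal_mul (NNReal.coe_nonneg _)]
  exact ENNReal.ofReal_le_ofReal (h k n (fun j => ω (j + k)) x hx y hy)

/-- A bounded distortion constant. -/
def distConst : ℝ≥0 := Φ.exists_distortion.choose

theorem one_le_distConst : 1 ≤ Φ.distConst := Φ.exists_distortion.choose_spec.1

theorem enorm_fderiv_le (ω : ∀ j, Φ.I j) (k n : ℕ) {x y : Euc d} (hx : x ∈ Φ.V) (hy : y ∈ Φ.V) :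
    ‖fderiv ℝ (Φ.seqMap ω k n) x‖ₑ ≤ Φ.distConst * ‖fderiv ℝ (Φ.seqMap ω k n) y‖ₑ :=
  Φ.exists_distortion.choose_spec.2 ω k n x hx y hy

theorem derivNorm_le (ω : ∀ j, Φ.I j) (k n : ℕ) {y : Euc d} (hy : y ∈ Φ.V) :
    derivNorm X (Φ.seqMap ω k n) ≤ Φ.distConst * ‖fderiv ℝ (Φ.seqMap ω k n) y‖ₑ :=
  iSup₂_le fun _ hx => Φ.enorm_fderiv_le ω k n (Φ.subset_V hx) hy

theorem enorm_fderiv_le_mul_derivNorm (hX : X.Nonempty) (ω : ∀ j, Φ.I j) (k n : ℕ) {x : Euc d}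
    (hx : x ∈ Φ.V) :
    ‖fderiv ℝ (Φ.seqMap ω k n) x‖ₑ ≤ Φ.distConst * derivNorm X (Φ.seqMap ω k n) := by
  obtain ⟨y, hy⟩ := hX
  exact (Φ.enorm_fderiv_le ω k n hx (Φ.subset_V hy)).trans
    (mul_le_mul_right (enorm_fderiv_le_derivNorm hy) _)

theorem derivNorm_ne_top (hX : X.Nonempty) (ω : ∀ j, Φ.I j) (k n : ℕ) :
    derivNorm X (Φ.seqMap ω k n) ≠ ⊤ := by
  obtain ⟨y, hy⟩ := hX
  exact ((Φ.derivNorm_le ω k n (Φ.subset_V hy)).trans_lt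
    (ENNReal.mul_lt_top ENNReal.coe_lt_top enorm_lt_top)).ne

theorem exists_derivNorm_le_pow : ∃ η : ℝ≥0, 0 < η ∧ η < 1 ∧ ∃ m₀ : ℕ, ∀ m ≥ m₀,
    ∀ (ω : ∀ j, Φ.I j) (k : ℕ), derivNorm X (Φ.seqMap ω k (m + 1)) ≤ (η : ℝ≥0∞) ^ m := by
  obtain ⟨η, h0, h1, m₀, h⟩ := Φ.contraction
  lift η to ℝ≥0 using h0.le
  refine ⟨η, h0, h1, m₀, fun m hm ω k => iSup₂_le fun x hx => ?_⟩
  rw [← ofReal_norm, ← ENNReal.ofReal_coe_nnreal, ← ENNReal.ofReal_pow (NNReal.coe_nonneg _)]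
  exact ENNReal.ofReal_le_ofReal (h m hm k (fun j => ω (j + k)) x hx)

variable [Nontrivial (Euc d)]

theorem derivNorm_ne_zero (hX : X.Nonempty) (ω : ∀ j, Φ.I j) (k n : ℕ) :
    derivNorm X (Φ.seqMap ω k n) ≠ 0 := by
  obtain ⟨y, hy⟩ := hX
  have h := enorm_fderiv_le_derivNorm (f := Φ.seqMap ω k n) hy
  intro h0
  rw [h0, nonpos_iff_eq_zero] at h
  exact isConformalMap_enorm_ne_zero (Φ.seqMap_isConformalMap ω k n (Φ.subset_V hy)) h

theorem derivNorm_id (hX : X.Nonempty) : derivNorm X (id : Euc d → Euc d) = 1 := by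
  have : Nonempty X := hX.to_subtype
  simp [derivNorm, fderiv_id, ← ofReal_norm, iSup_subtype']

theorem enorm_fderiv_seqMap_add (ω : ∀ j, Φ.I j) (k n m : ℕ) {x : Euc d} (hx : x ∈ Φ.V) :
    ‖fderiv ℝ (Φ.seqMap ω k (n + m)) x‖ₑ =
      ‖fderiv ℝ (Φ.seqMap ω k n) (Φ.seqMap ω (k + n) m x)‖ₑ *
        ‖fderiv ℝ (Φ.seqMap ω (k + n) m) x‖ₑ := by
  have hy := Φ.seqMap_mapsTo_V ω (k + n) m hx
  rw [seqMap_add, fderiv_comp _ (Φ.seqMap_differentiableAt ω k n hy)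
    (Φ.seqMap_differentiableAt ω (k + n) m hx),
    isConformalMap_enorm_comp (Φ.seqMap_isConformalMap ω k n hy)]

theorem derivNorm_add_le (ω : ∀ j, Φ.I j) (k n m : ℕ) :
    derivNorm X (Φ.seqMap ω k (n + m)) ≤
      derivNorm X (Φ.seqMap ω k n) * derivNorm X (Φ.seqMap ω (k + n) m) := by
  refine iSup₂_le fun x hx => ?_
  rw [Φ.enorm_fderiv_seqMap_add ω k n m (Φ.subset_V hx)]
  exact mul_le_mul' (enorm_fderiv_le_derivNorm (Φ.seqMap_mapsTo ω _ _ hx))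
    (enorm_fderiv_le_derivNorm hx)

/-- By distortion the outer derivative may be evaluated at the point reached by the inner map, where
the chain rule is exact. -/
theorem derivNorm_mul_le (ω : ∀ j, Φ.I j) (k n m : ℕ) :
    derivNorm X (Φ.seqMap ω k n) * derivNorm X (Φ.seqMap ω (k + n) m) ≤
      Φ.distConst * derivNorm X (Φ.seqMap ω k (n + m)) := by
  conv_lhs => rw [derivNorm, derivNorm]
  simp_rw [ENNReal.mul_iSup]
  refine iSup₂_le fun x hx => ?_
  refine (mul_le_mul_left (Φ.derivNorm_le ω k n
    (Φ.seqMap_mapsTo_V ω (k + n) m (Φ.subset_V hx))) _).trans ?_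
  rw [mul_assoc, ← Φ.enorm_fderiv_seqMap_add ω k n m (Φ.subset_V hx)]
  exact mul_le_mul_right (enorm_fderiv_le_derivNorm hx) _

end DerivNorm

end NCIFS

namespace NCIFS

variable {d : ℕ} {X : Set (Euc d)} (Φ : NCIFS X)

/-! ### Prefixes, cylinders and their mass -/

section Words

/-- An infinite sequence extending a given finite word. -/
def extend {n : ℕ} (σ : Φ.Word n) : ∀ j, Φ.I j := fun j =>
  if h : j < n then σ ⟨j, h⟩ else Classical.choice (Φ.nonempty j)

/-- The initial word of length `n` of an infinite sequence. -/
def initial (ω : ∀ j, Φ.I j) (n : ℕ) : Φ.Word n := fun j => ω j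

theorem extend_apply {n : ℕ} (σ : Φ.Word n) (j : Fin n) : Φ.extend σ j = σ j := by
  simp [extend]

theorem initial_extend {n : ℕ} (σ : Φ.Word n) : Φ.initial (Φ.extend σ) n = σ := by
  funext j
  exact Φ.extend_apply σ j

theorem initial_eq_iff {ω ω' : ∀ j, Φ.I j} {n : ℕ} :
    Φ.initial ω n = Φ.initial ω' n ↔ ∀ j < n, ω j = ω' j :=
  ⟨fun h j hj => congrFun h ⟨j, hj⟩, fun h => funext fun j => h j j.2⟩

theorem map_eq_seqMap {n : ℕ} (σ : Φ.Word n) : Φ.map σ = Φ.seqMap (Φ.extend σ) 0 n := by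
  conv_lhs => rw [← Φ.initial_extend σ]
  rfl

theorem map_initial (ω : ∀ j, Φ.I j) (n : ℕ) : Φ.map (Φ.initial ω n) = Φ.seqMap ω 0 n := rfl

/-- The sequence `ω` with its initial part replaced by the word `σ`. -/
def splice {k : ℕ} (σ : Φ.Word k) (ω : ∀ j, Φ.I j) : ∀ j, Φ.I j := fun j =>
  if h : j < k then σ ⟨j, h⟩ else ω j

theorem splice_of_le {k : ℕ} (σ : Φ.Word k) (ω : ∀ j, Φ.I j) {j : ℕ} (h : k ≤ j) :
    Φ.splice σ ω j = ω j := dif_neg (by omega)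

theorem initial_splice {k : ℕ} (σ : Φ.Word k) (ω : ∀ j, Φ.I j) :
    Φ.initial (Φ.splice σ ω) k = σ := by
  funext j
  simp [initial, splice]

/-- The words of length `n` with initial word `σ`. -/
def cylinder {k : ℕ} (σ : Φ.Word k) (n : ℕ) : Set (Φ.Word n) :=
  {ω | Φ.initial (Φ.extend ω) k = σ}

/-- Replacing the prefix `σ` of `ω` by `τ` multiplies the norm by `‖Dφ_τ‖ / ‖Dφ_σ‖`, up to the
distortion constant, and the pair `(ω, τ)` can be recovered from the new word. Dividing by both
sums, the mass of a cylinder at level `n` is controlled by its mass at level `k`. -/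
theorem tsum_cylinder_mul_Z_le [Nontrivial (Euc d)] (t : ℝ≥0) {k n : ℕ} (hkn : k ≤ n)
    (σ : Φ.Word k) :
    (∑' ω : Φ.cylinder σ n, derivNorm X (Φ.map ω.1) ^ (t : ℝ)) * Φ.Z k t ≤
      (Φ.distConst : ℝ≥0∞) ^ (t : ℝ) * derivNorm X (Φ.map σ) ^ (t : ℝ) * Φ.Z n t := by
  obtain ⟨m, rfl⟩ := Nat.exists_eq_add_of_le hkn
  let F : Φ.cylinder σ (k + m) × Φ.Word k → Φ.Word (k + m) := fun p =>
    Φ.initial (Φ.splice p.2 (Φ.extend p.1.1)) (k + m)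
  have hF : Function.Injective F := by
    rintro ⟨⟨ω, hω⟩, τ⟩ ⟨⟨ω', hω'⟩, τ'⟩ h
    have h' := Φ.initial_eq_iff.1 h
    have h1 : τ = τ' := by
      rw [← Φ.initial_splice τ (Φ.extend ω), ← Φ.initial_splice τ' (Φ.extend ω'), initial_eq_iff]
      exact fun j hj => h' j (by omega)
    have h2 : ω = ω' := by
      rw [← Φ.initial_extend ω, ← Φ.initial_extend ω', initial_eq_iff]
      intro j hj
      by_cases hjk : j < k
      · exact Φ.initial_eq_iff.1 (hω.trans hω'.symm) j hjk
      · have := h' j hj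
        rwa [splice_of_le _ _ _ (by omega), splice_of_le _ _ _ (by omega)] at this
    subst h1 h2
    rfl
  have hterm : ∀ p : Φ.cylinder σ (k + m) × Φ.Word k,
      derivNorm X (Φ.map p.1.1) ^ (t : ℝ) * derivNorm X (Φ.map p.2) ^ (t : ℝ) ≤
        (Φ.distConst : ℝ≥0∞) ^ (t : ℝ) * derivNorm X (Φ.map σ) ^ (t : ℝ) *
          derivNorm X (Φ.map (F p)) ^ (t : ℝ) := by
    rintro ⟨⟨ω, hω⟩, τ⟩
    have ht : (0 : ℝ) ≤ t := t.2
    rw [← ENNReal.mul_rpow_of_nonneg _ _ ht, ← ENNReal.mul_rpow_of_nonneg _ _ ht,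
      ← ENNReal.mul_rpow_of_nonneg _ _ ht]
    refine ENNReal.rpow_le_rpow ?_ ht
    have e1 : Φ.map σ = Φ.seqMap (Φ.extend ω) 0 k := by
      rw [← hω]; rfl
    have e2 : Φ.map τ = Φ.seqMap (Φ.splice τ (Φ.extend ω)) 0 k := by
      conv_lhs => rw [← Φ.initial_splice τ (Φ.extend ω)]
      rfl
    have e3 : Φ.seqMap (Φ.extend ω) (0 + k) m = Φ.seqMap (Φ.splice τ (Φ.extend ω)) (0 + k) m :=
      Φ.seqMap_congr fun j hj _ => (Φ.splice_of_le _ _ (by omega)).symm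
    have e4 : Φ.map (F (⟨ω, hω⟩, τ)) = Φ.seqMap (Φ.splice τ (Φ.extend ω)) 0 (k + m) := rfl
    have b1 := Φ.derivNorm_add_le (Φ.extend ω) 0 k m
    have b2 := Φ.derivNorm_mul_le (Φ.splice τ (Φ.extend ω)) 0 k m
    rw [← e1, e3] at b1
    rw [← e2] at b2
    rw [e4]
    show derivNorm X (Φ.map ω) * derivNorm X (Φ.map τ) ≤ _
    rw [Φ.map_eq_seqMap ω]
    calc _ ≤ derivNorm X (Φ.map σ) *
          derivNorm X (Φ.seqMap (Φ.splice τ (Φ.extend ω)) (0 + k) m) * derivNorm X (Φ.map τ) :=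
          mul_le_mul_left b1 _
      _ = derivNorm X (Φ.map σ) * (derivNorm X (Φ.map τ) *
          derivNorm X (Φ.seqMap (Φ.splice τ (Φ.extend ω)) (0 + k) m)) := by ring
      _ ≤ derivNorm X (Φ.map σ) * _ := mul_le_mul_right b2 _
      _ = _ := by ring
  calc _ = ∑' p : Φ.cylinder σ (k + m) × Φ.Word k,
        derivNorm X (Φ.map p.1.1) ^ (t : ℝ) * derivNorm X (Φ.map p.2) ^ (t : ℝ) := by
        rw [ENNReal.tsum_prod', Z, ← ENNReal.tsum_mul_right]
        simp_rw [ENNReal.tsum_mul_left]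
    _ ≤ ∑' p, (Φ.distConst : ℝ≥0∞) ^ (t : ℝ) * derivNorm X (Φ.map σ) ^ (t : ℝ) *
          derivNorm X (Φ.map (F p)) ^ (t : ℝ) := ENNReal.tsum_le_tsum hterm
    _ = (Φ.distConst : ℝ≥0∞) ^ (t : ℝ) * derivNorm X (Φ.map σ) ^ (t : ℝ) *
          ∑' p, derivNorm X (Φ.map (F p)) ^ (t : ℝ) := ENNReal.tsum_mul_left
    _ ≤ _ := mul_le_mul_right (ENNReal.tsum_comp_le_tsum_of_injective hF
          (fun ω => derivNorm X (Φ.map ω) ^ (t : ℝ))) _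

end Words

/-! ### Compactness of the limit set and the mass distribution principle -/

section LimitSet

theorem finite_word (hΦ : Φ.IsFinite) (n : ℕ) : Finite (Φ.Word n) :=
  have : ∀ j : Fin n, Finite (Φ.I (j + 0)) := fun _ => hΦ _
  inferInstance

theorem iUnion_image_antitone : Antitone fun n : ℕ => ⋃ ω : Φ.Word n, Φ.map ω '' X := by
  refine antitone_nat_of_succ_le fun n => iUnion_subset fun ω => ?_
  rw [Φ.map_eq_seqMap, seqMap_succ, image_comp]
  refine (image_mono (Φ.mapsTo _ _).image_subset).trans ?_
  exact subset_iUnion (fun ω : Φ.Word n => Φ.map ω '' X) (Φ.initial (Φ.extend ω) n)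

theorem limitSet_subset (n : ℕ) : Φ.limitSet ⊆ ⋃ ω : Φ.Word n, Φ.map ω '' X :=
  (iInter_subset _ n).trans (Φ.iUnion_image_antitone n.le_succ)

theorem isCompact_iUnion_image (hX : IsCompact X) (hΦ : Φ.IsFinite) (n : ℕ) :
    IsCompact (⋃ ω : Φ.Word n, Φ.map ω '' X) := by
  have := Φ.finite_word hΦ n
  refine isCompact_iUnion fun ω => hX.image_of_continuousOn ?_
  rw [Φ.map_eq_seqMap]
  exact Φ.seqMap_continuousOn _ _ _

/-- The strict inequality `a < ρ` lets sets of any diameter, even zero, be enclosed in open balls at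
a small cost in the `t`-sum. -/
theorem exists_radius {r₀ t : ℝ} (ht : 0 < t) {a : ℝ≥0∞} (ha : a < ENNReal.ofReal r₀)
    {δ : ℝ≥0} (hδ : 0 < δ) :
    ∃ ρ : ℝ, 0 < ρ ∧ ρ < r₀ ∧ a < ENNReal.ofReal ρ ∧ ENNReal.ofReal ρ ^ t ≤ a ^ t + δ := by
  have hev : ∀ᶠ x in 𝓝[>] a, x ^ t < a ^ t + δ :=
    nhdsWithin_le_nhds <| (ENNReal.continuous_rpow_const.tendsto a).eventually_lt_const
      (ENNReal.lt_add_right (ENNReal.rpow_ne_top_of_nonneg ht.le ha.ne_top)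
        (by exact_mod_cast hδ.ne'))
  have hev2 : ∀ᶠ x in 𝓝[>] a, x < ENNReal.ofReal r₀ := nhdsWithin_le_nhds (eventually_lt_nhds ha)
  have hev3 : ∀ᶠ x in 𝓝[>] a, a < x := self_mem_nhdsWithin
  have : (𝓝[>] a).NeBot := nhdsGT_neBot_of_exists_gt ⟨_, ha⟩
  obtain ⟨x, hx1, hx2, hx3⟩ := (hev.and (hev2.and hev3)).exists
  have hxt : x ≠ ⊤ := hx2.ne_top
  refine ⟨x.toReal, ENNReal.toReal_pos (bot_le.trans_lt hx3).ne' hxt,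
    (ENNReal.lt_ofReal_iff_toReal_lt hxt).1 hx2, ?_, ?_⟩
  · rwa [ENNReal.ofReal_toReal hxt]
  · rw [ENNReal.ofReal_toReal hxt]
    exact hx1.le

/-- A mass distribution principle: a family of weights on the words of length `n`, `n → ∞`, which
gives mass at most `C r ^ t` to balls of radius `r`, bounds the dimension of the limit set from
below. -/
theorem le_dimH_limitSet_of_weights (hX : IsCompact X) (hΦ : Φ.IsFinite) {p : Euc d} (hp : p ∈ X)
    {t : ℝ≥0} (w : ∀ n, Φ.Word n → ℝ≥0∞) (hw : ∀ᶠ n in atTop, 1 ≤ ∑' ω, w n ω) {C : ℝ≥0}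
    {r₀ : ℝ} (hr₀ : 0 < r₀)
    (h : ∀ r, 0 < r → r < r₀ → ∀ᶠ n in atTop, ∀ x,
      ∑' ω : {ω : Φ.Word n | Φ.map ω p ∈ Metric.ball x r}, w n ω ≤ C * ENNReal.ofReal r ^ (t : ℝ)) :
    (t : ℝ≥0∞) ≤ dimH Φ.limitSet := by
  rcases eq_or_ne t 0 with rfl | ht0
  · simp
  have htpos : (0 : ℝ) < t := by positivity
  refine le_dimH_of_hausdorffMeasure_ne_zero fun hμ => ?_
  rw [Measure.hausdorffMeasure_apply] at hμ
  simp only [ENNReal.iSup_eq_zero] at hμ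
  have hμ' := hμ (ENNReal.ofReal (r₀ / 2)) (by simpa using hr₀)
  -- One `ε` pays for the diameters of the cover, the other for their enlargement to open balls.
  set ε : ℝ≥0∞ := (2 * (C + 1))⁻¹ with hε
  have hε0 : ε ≠ 0 := by simp [hε, ENNReal.mul_eq_top]
  have hCε : C * (ε + ε) < 1 := by
    have : ε + ε = ((C : ℝ≥0∞) + 1)⁻¹ := by
      rw [hε, ENNReal.mul_inv (by simp) (by simp), ← add_mul, ENNReal.inv_two_add_inv_two, one_mul]
    rw [this, ← div_eq_mul_inv]
    refine ENNReal.div_lt_of_lt_mul ?_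
    rw [one_mul]
    exact ENNReal.lt_add_right (by simp) one_ne_zero
  have hlt := hμ'.trans_lt (pos_iff_ne_zero.2 hε0)
  simp only [iInf_lt_iff] at hlt
  obtain ⟨T, hcov, hdiam, hsum⟩ := hlt
  obtain ⟨δ, hδ0, hδ⟩ := ENNReal.exists_pos_sum_of_countable hε0 ℕ
  have hρ := fun i => exists_radius htpos
    ((hdiam i).trans_lt ((ENNReal.ofReal_lt_ofReal_iff hr₀).2 (half_lt_self hr₀))) (hδ0 i)
  choose ρ hρ0 hρr hρd hρt using hρ
  let U : ℕ → Set (Euc d) := fun i => ⋃ h : (T i).Nonempty, Metric.ball h.some (ρ i)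
  have hUo : ∀ i, IsOpen (U i) := fun i => isOpen_iUnion fun _ => Metric.isOpen_ball
  have hTU : ∀ i, T i ⊆ U i := by
    intro i x hx
    have hne : (T i).Nonempty := ⟨x, hx⟩
    refine mem_iUnion.2 ⟨hne, ?_⟩
    have h1 : edist x hne.some < ENNReal.ofReal (ρ i) :=
      (Metric.edist_le_ediam_of_mem hx hne.some_mem).trans_lt (hρd i)
    rwa [edist_dist, ENNReal.ofReal_lt_ofReal_iff (hρ0 i)] at h1
  -- An open cover of the limit set already covers a finite-level approximation, hence all points
  -- `map ω p` of later levels. Weights at finite levels therefore suffice and no limit measure is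
  -- needed.
  obtain ⟨N, hN⟩ := exists_subset_nhds_of_isCompact
    (V := fun n : ℕ => ⋃ ω : Φ.Word (n + 1), Φ.map ω '' X)
    (directed_of_isDirected_le fun m n hmn => Φ.iUnion_image_antitone (Nat.succ_le_succ hmn))
    (fun n => Φ.isCompact_iUnion_image hX hΦ (n + 1)) (U := ⋃ i, U i)
    (fun x hx => (isOpen_iUnion hUo).mem_nhds (iUnion_mono hTU (hcov hx)))
  obtain ⟨F, hF⟩ := (Φ.isCompact_iUnion_image hX hΦ (N + 1)).elim_finite_subcover U hUo hN
  have hev : ∀ᶠ n in atTop, ∀ i ∈ F, ∀ x,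
      ∑' ω : {ω : Φ.Word n | Φ.map ω p ∈ Metric.ball x (ρ i)}, w n ω ≤
        C * ENNReal.ofReal (ρ i) ^ (t : ℝ) :=
    (Finset.eventually_all F).2 fun i _ => h (ρ i) (hρ0 i) (hρr i)
  obtain ⟨n, ⟨hn1, hn2⟩, hn3⟩ := ((hw.and hev).and (eventually_ge_atTop (N + 1))).exists
  have hcovn : ∀ ω : Φ.Word n, ∃ i ∈ F, Φ.map ω p ∈ U i := by
    intro ω
    have := hF (Φ.iUnion_image_antitone hn3 (mem_iUnion.2 ⟨ω, mem_image_of_mem _ hp⟩))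
    simpa using this
  have hpiece : ∀ i ∈ F, ∑' ω : {ω : Φ.Word n | Φ.map ω p ∈ U i}, w n ω ≤
      C * ((⨆ _ : (T i).Nonempty, Metric.ediam (T i) ^ (t : ℝ)) + δ i) := by
    intro i hi
    by_cases hT : (T i).Nonempty
    · have hUi : U i = Metric.ball hT.some (ρ i) := by simp [U, hT]
      rw [hUi]
      refine (hn2 i hi _).trans (mul_le_mul_right ?_ _)
      simpa [hT] using hρt i
    · have hUi : U i = ∅ := by simp [U, hT]
      rw [hUi]
      simp
  have : (1 : ℝ≥0∞) < 1 := by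
    calc (1 : ℝ≥0∞) ≤ ∑' ω, w n ω := hn1
      _ ≤ ∑' ω, ∑ i ∈ F, indicator {ω : Φ.Word n | Φ.map ω p ∈ U i} (w n) ω := by
          refine ENNReal.tsum_le_tsum fun ω => ?_
          obtain ⟨i, hi, hω⟩ := hcovn ω
          refine le_trans (le_of_eq ?_) (Finset.single_le_sum (fun _ _ => zero_le) hi)
          exact (indicator_of_mem (s := {ω : Φ.Word n | Φ.map ω p ∈ U i}) hω _).symm
      _ = ∑ i ∈ F, ∑' ω : {ω : Φ.Word n | Φ.map ω p ∈ U i}, w n ω := by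
          rw [Summable.tsum_finsetSum fun _ _ => ENNReal.summable]
          simp_rw [tsum_subtype]
      _ ≤ ∑ i ∈ F, C * ((⨆ _ : (T i).Nonempty, Metric.ediam (T i) ^ (t : ℝ)) + δ i) :=
          Finset.sum_le_sum hpiece
      _ ≤ ∑' i, C * ((⨆ _ : (T i).Nonempty, Metric.ediam (T i) ^ (t : ℝ)) + δ i) :=
          ENNReal.sum_le_tsum _
      _ ≤ C * (ε + ε) := by
          rw [ENNReal.tsum_mul_left, ENNReal.tsum_add]
          gcongr
      _ < 1 := hCε
  exact lt_irrefl _ this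

end LimitSet

end NCIFS

/-! ### Interior balls at all small scales in a phase space -/

section Corkscrew

variable {d : ℕ} {X : Set (Euc d)}

/-- Every ball of radius `s ≤ l` around a point of `S` contains a ball of radius `c * s` which is
contained in `X`. -/
def Corkscrew (X S : Set (Euc d)) (c l : ℝ) : Prop :=
  ∀ q ∈ S, ∀ s, 0 < s → s ≤ l → ∃ y, Metric.ball y (c * s) ⊆ X ∩ Metric.closedBall q s

theorem Corkscrew.mono {S S' : Set (Euc d)} {c c' l l' : ℝ} (h : Corkscrew X S c l) (hS : S' ⊆ S)
    (hc : c' ≤ c) (hl : l' ≤ l) : Corkscrew X S' c' l' := fun q hq s h0 hs => by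
  obtain ⟨y, hy⟩ := h q (hS hq) s h0 (hs.trans hl)
  exact ⟨y, (Metric.ball_subset_ball (mul_le_mul_of_nonneg_right hc h0.le)).trans hy⟩

theorem IsCompact.exists_corkscrew (hX : IsCompact X)
    (h : ∀ p ∈ X, ∃ N ∈ 𝓝 p, ∃ c l : ℝ, 0 < c ∧ 0 < l ∧ Corkscrew X (X ∩ N) c l) :
    ∃ c l : ℝ, 0 < c ∧ 0 < l ∧ Corkscrew X X c l := by
  refine hX.induction_on (p := fun S => ∃ c l : ℝ, 0 < c ∧ 0 < l ∧ Corkscrew X S c l) ?_ ?_ ?_ ?_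
  · exact ⟨1, 1, one_pos, one_pos, fun q hq => hq.elim⟩
  · rintro S T hST ⟨c, l, hc, hl, H⟩
    exact ⟨c, l, hc, hl, H.mono hST le_rfl le_rfl⟩
  · rintro S T ⟨c, l, hc, hl, H⟩ ⟨c', l', hc', hl', H'⟩
    refine ⟨min c c', min l l', lt_min hc hc', lt_min hl hl', ?_⟩
    rintro q (hq | hq)
    · exact H.mono Subset.rfl (min_le_left _ _) (min_le_left _ _) q hq
    · exact H'.mono Subset.rfl (min_le_right _ _) (min_le_right _ _) q hq
  · intro p hp
    obtain ⟨N, hN, c, l, hc, hl, H⟩ := h p hp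
    exact ⟨X ∩ N, inter_mem_nhdsWithin _ hN, c, l, hc, hl, H⟩

/-- The homothety centred at `q` with factor `s / (D + R)` carries a fixed interior ball into `X`,
within distance `s` of `q`. -/
theorem exists_corkscrew_of_convex (hX : IsCompact X) (hi : (interior X).Nonempty)
    (hc : Convex ℝ X) : ∃ c l : ℝ, 0 < c ∧ 0 < l ∧ Corkscrew X X c l := by
  obtain ⟨z, hz⟩ := hi
  obtain ⟨R, hR, hRX⟩ := Metric.isOpen_iff.1 isOpen_interior z hz
  obtain ⟨D, hD⟩ := hX.isBounded.subset_closedBall z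
  have hD0 : 0 ≤ D := dist_nonneg.trans (hD (interior_subset hz))
  refine ⟨R / (D + R), D + R, by positivity, by positivity, fun q hq s hs0 hs => ?_⟩
  set u := s / (D + R) with hu
  have hu0 : 0 < u := by positivity
  have hu1 : u ≤ 1 := (div_le_one (by positivity)).2 hs
  have hus : u * (D + R) = s := by rw [hu]; field_simp
  refine ⟨q + u • (z - q), fun y hy => ?_⟩
  have hcs : R / (D + R) * s = u * R := by rw [hu]; ring
  rw [hcs, mem_ball_iff_norm] at hy
  set w := z + u⁻¹ • (y - (q + u • (z - q))) with hw
  have hwz : w ∈ Metric.ball z R := by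
    rw [mem_ball_iff_norm, hw, add_sub_cancel_left, norm_smul, norm_inv, Real.norm_of_nonneg hu0.le,
      inv_mul_lt_iff₀ hu0]
    exact hy
  have hyw : y = (1 - u) • q + u • w := by
    rw [hw, smul_add, smul_smul, mul_inv_cancel₀ hu0.ne']
    module
  constructor
  · rw [hyw]
    exact hc hq (interior_subset (hRX hwz)) (by linarith) hu0.le (by ring)
  · rw [mem_closedBall_iff_norm, show y - q = u • ((w - z) - (q - z)) by rw [hyw]; module,
      norm_smul, Real.norm_of_nonneg hu0.le, ← hus]
    have h1 := mem_ball_iff_norm.1 hwz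
    have h2 := mem_closedBall_iff_norm.1 (hD hq)
    have h3 := norm_sub_le (w - z) (q - z)
    gcongr
    linarith

/-- A direction `u` with `Df(u) = -1` points into `X`. Strict differentiability makes the linear
approximation of `f` uniform over nearby base points `q`, so a step `τ • u` from `q`, even slightly
perturbed, stays in `f ≤ 0`. Compactness makes the local constants uniform. -/
theorem exists_corkscrew_of_hasC1Boundary (hX : IsCompact X) (hb : HasC1Boundary X) :
    ∃ c l : ℝ, 0 < c ∧ 0 < l ∧ Corkscrew X X c l := by
  refine hX.exists_corkscrew fun p hp => ?_
  by_cases hpi : p ∈ interior X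
  · obtain ⟨ε, hε, hεX⟩ := Metric.isOpen_iff.1 isOpen_interior p hpi
    refine ⟨Metric.ball p (ε / 2), Metric.ball_mem_nhds _ (by positivity), 1, ε / 2, one_pos,
      by positivity, ?_⟩
    rintro q ⟨-, hq⟩ s - hs
    refine ⟨q, fun y hy => ⟨interior_subset (hεX ?_), ?_⟩⟩
    · rw [one_mul] at hy
      have := dist_triangle y q p
      rw [Metric.mem_ball] at *
      linarith
    · rw [one_mul] at hy
      exact Metric.ball_subset_closedBall hy
  obtain ⟨U, f, hU, hpU, hf, ha, hXU⟩ := hb p ⟨subset_closure hp, hpi⟩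
  set a := fderiv ℝ f p with ha'
  have hstr : HasStrictFDerivAt f a p :=
    (hf.contDiffAt (hU.mem_nhds hpU)).hasStrictFDerivAt one_ne_zero
  obtain ⟨u, hu⟩ : ∃ u, a u = -1 := by
    obtain ⟨v, hv⟩ : ∃ v, a v ≠ 0 := by
      by_contra! h
      exact ha (ContinuousLinearMap.ext h)
    exact ⟨(-(a v)⁻¹) • v, by rw [map_smul, smul_eq_mul]; field_simp⟩
  -- The linear part decreases by `τ`; `ε` and, below, `κ` are chosen so that the linearization
  -- error and the perturbation each cost at most `τ / 4`.
  set ε : ℝ≥0 := 1 / (4 * (‖u‖₊ + 1)) with hε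
  have hεu : (ε : ℝ) * (‖u‖ + 1) = 1 / 4 := by
    rw [hε]; push_cast; field_simp
  obtain ⟨S, hS, hap⟩ := hstr.approximates_deriv_on_nhds (c := ε) (Or.inr (by positivity))
  obtain ⟨ρ, hρ, hρS⟩ := Metric.mem_nhds_iff.1 (inter_mem hS (hU.mem_nhds hpU))
  set κ : ℝ := 1 / (4 * (‖a‖ + 1)) with hκ
  have hκ0 : 0 < κ := by positivity
  have hκa : ‖a‖ * κ ≤ 1 / 4 := by
    rw [hκ, mul_one_div, div_le_div_iff₀ (by positivity) (by positivity)]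
    linarith
  have hκ1 : κ ≤ 1 := by
    rw [hκ, div_le_one (by positivity)]
    linarith [norm_nonneg a]
  refine ⟨Metric.ball p (ρ / 2), Metric.ball_mem_nhds _ (by positivity), κ / (‖u‖ + 1), ρ / 4,
    by positivity, by positivity, ?_⟩
  rintro q ⟨hqX, hq⟩ s hs0 hs
  set τ := s / (‖u‖ + 1) with hτ
  have hτ0 : 0 < τ := by positivity
  have hτs : τ * (‖u‖ + 1) = s := by rw [hτ]; field_simp
  refine ⟨q + τ • u, fun y hy => ?_⟩
  have e : κ / (‖u‖ + 1) * s = κ * τ := by rw [hτ]; ring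
  rw [e, mem_ball_iff_norm] at hy
  set v := y - (q + τ • u) with hv
  have hyq : y - q = τ • u + v := by rw [hv]; module
  have hnu : ‖τ • u‖ = τ * ‖u‖ := by rw [norm_smul, Real.norm_of_nonneg hτ0.le]
  have hyqn : ‖y - q‖ ≤ s := by
    rw [hyq]
    have := norm_add_le (τ • u) v
    nlinarith
  refine ⟨?_, mem_closedBall_iff_norm.2 hyqn⟩
  have hqρ : q ∈ Metric.ball p ρ := Metric.ball_subset_ball (by linarith) hq
  have hyρ : y ∈ Metric.ball p ρ := by
    have h1 := dist_triangle y q p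
    rw [dist_eq_norm y q] at h1
    rw [Metric.mem_ball] at *
    linarith
  have hfq : f q ≤ 0 := by
    have : q ∈ X ∩ U := ⟨hqX, (hρS hqρ).2⟩
    rw [hXU] at this
    exact this.2
  have happ := hap y (hρS hyρ).1 q (hρS hqρ).1
  have h1 : a (y - q) ≤ -τ + ‖a‖ * (κ * τ) := by
    rw [hyq, map_add, map_smul, hu, smul_eq_mul]
    have h2 : a v ≤ ‖a‖ * ‖v‖ := (le_abs_self _).trans (a.le_opNorm v)
    have h3 : ‖a‖ * ‖v‖ ≤ ‖a‖ * (κ * τ) := by gcongr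
    linarith
  have h2 : (ε : ℝ) * ‖y - q‖ ≤ τ / 4 := by
    calc (ε : ℝ) * ‖y - q‖ ≤ ε * s := by gcongr
      _ = τ / 4 := by rw [← hτs, mul_left_comm, hεu]; ring
  have h3 := (le_abs_self _).trans happ
  have h4 : ‖a‖ * (κ * τ) ≤ τ / 4 := by nlinarith
  have hfy : f y ≤ 0 := by linarith
  have : y ∈ X ∩ U := by
    rw [hXU]
    exact ⟨(hρS hyρ).2, hfy⟩
  exact this.1

/-- Unless the ball of radius `s / 2` around `q` lies in `X`, connectedness yields a boundary point
`p` in it, and the cone at `p` contains a ball around `p + (s / 4) • u`. -/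
theorem exists_corkscrew_of_coneCondition (h : ConeCondition X) :
    ∃ c l : ℝ, 0 < c ∧ 0 < l ∧ Corkscrew X X c l := by
  obtain ⟨c, l, hc0, hc1, hl, H⟩ := h
  refine ⟨(1 - c) / 8, l, by linarith, hl, fun q hq s hs0 hs => ?_⟩
  by_cases hb : Metric.ball q (s / 2) ⊆ X
  · refine ⟨q, subset_inter ((Metric.ball_subset_ball ?_).trans hb)
      ((Metric.ball_subset_ball ?_).trans Metric.ball_subset_closedBall)⟩ <;> nlinarith
  obtain ⟨p, hpb, hpX⟩ : (Metric.ball q (s / 2) ∩ frontier X).Nonempty := by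
    obtain ⟨x, hx, hxX⟩ := not_subset.1 hb
    by_contra hne
    have hcov : ∀ y ∈ Metric.ball q (s / 2), y ∈ interior X ∨ y ∈ interior Xᶜ := by
      intro y hy
      by_contra! h
      refine hne ⟨y, hy, ?_, h.1⟩
      rw [interior_compl, notMem_compl_iff] at h
      exact h.2
    obtain ⟨y, -, hy1, hy2⟩ := (convex_ball q (s / 2)).isPreconnected _ _ isOpen_interior
      isOpen_interior hcov
      ⟨q, Metric.mem_ball_self (by positivity),
        (hcov q (Metric.mem_ball_self (by positivity))).resolve_right
        fun h => interior_subset h hq⟩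
      ⟨x, hx, (hcov x hx).resolve_left fun h => hxX (interior_subset h)⟩
    exact interior_subset hy2 (interior_subset hy1)
  obtain ⟨u, hu, hcone⟩ := H p hpX
  refine ⟨p + (s / 4) • u, fun y hy => ?_⟩
  rw [mem_ball_iff_norm] at hy
  set v := y - (p + (s / 4) • u) with hv
  have hyp : y - p = (s / 4) • u + v := by rw [hv]; module
  have hsu : ‖(s / 4) • u‖ = s / 4 := by
    rw [norm_smul, hu, mul_one, Real.norm_of_nonneg (by positivity)]
  have hn : ‖y - p‖ ≤ s / 4 + (1 - c) / 8 * s := by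
    rw [hyp]
    have := norm_add_le ((s / 4) • u) v
    linarith
  have hin : s / 4 - (1 - c) / 8 * s < inner ℝ u (y - p) := by
    rw [hyp, inner_add_right, inner_smul_right, real_inner_self_eq_norm_sq, hu]
    have h1 := (abs_le.1 (abs_real_inner_le_norm u v)).1
    rw [hu, one_mul] at h1
    linarith
  constructor
  · refine interior_subset (hcone ⟨?_, ?_, ?_⟩)
    · rintro rfl
      rw [sub_self, inner_zero_right] at hin
      nlinarith
    · nlinarith
    -- The two sides of the remaining inequality differ by `(1 - c) ^ 2 * s / 8`.
    · refine lt_of_le_of_lt (mul_le_mul_of_nonneg_left hn hc0.le) (lt_of_le_of_lt ?_ hin)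
      nlinarith [mul_pos hs0 (sub_pos.2 hc1), mul_pos (mul_pos hs0 (sub_pos.2 hc1)) (sub_pos.2 hc1)]
  · rw [mem_closedBall_iff_norm]
    have h1 := norm_sub_le_norm_sub_add_norm_sub y p q
    have h2 := mem_ball_iff_norm.1 hpb
    nlinarith

theorem IsPhaseSpace.interior_nonempty (hX : IsPhaseSpace X) : (interior X).Nonempty := by
  rw [← closure_nonempty_iff, hX.closure_interior]
  exact hX.nonempty

theorem IsPhaseSpace.exists_corkscrew (hX : IsPhaseSpace X) :
    ∃ c l : ℝ, 0 < c ∧ 0 < l ∧ Corkscrew X X c l := by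
  rcases hX.geometry with h | h | h
  · exact exists_corkscrew_of_convex hX.isCompact hX.interior_nonempty h
  · exact exists_corkscrew_of_hasC1Boundary hX.isCompact h
  · exact exists_corkscrew_of_coneCondition h

end Corkscrew

/-! ### Diameter and volume of images; counting images that meet a ball -/

namespace NCIFS

variable {d : ℕ} {X : Set (Euc d)} (Φ : NCIFS X)

theorem exists_ball_subset_V (hX : IsCompact X) :
    ∃ δ : ℝ, 0 < δ ∧ ∀ x ∈ X, Metric.ball x δ ⊆ Φ.V := by
  obtain ⟨δ, hδ, h⟩ := hX.exists_thickening_subset_open Φ.isOpen_V Φ.subset_V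
  exact ⟨δ, hδ, fun x hx => (Metric.ball_subset_thickening hx δ).trans h⟩

/-- The mean value inequality needs a convex set, which `X` need not be. The distortion constant
appears because `S` may leave `X`, over which `derivNorm` is taken. -/
theorem norm_seqMap_sub_le (hX : X.Nonempty) (ω : ∀ j, Φ.I j) (k n : ℕ) {S : Set (Euc d)}
    (hS : Convex ℝ S) (hSV : S ⊆ Φ.V) {x y : Euc d} (hx : x ∈ S) (hy : y ∈ S) :
    ‖Φ.seqMap ω k n y - Φ.seqMap ω k n x‖ ≤
      Φ.distConst * (derivNorm X (Φ.seqMap ω k n)).toReal * ‖y - x‖ := by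
  refine hS.norm_image_sub_le_of_norm_fderiv_le (𝕜 := ℝ)
    (fun z hz => Φ.seqMap_differentiableAt ω k n (hSV hz)) (fun z hz => ?_) hx hy
  have h := Φ.enorm_fderiv_le_mul_derivNorm hX ω k n (hSV hz)
  have := ENNReal.toReal_mono
    (ENNReal.mul_ne_top ENNReal.coe_ne_top (Φ.derivNorm_ne_top hX ω k n)) h
  simpa using this

/-- Change of variables: the Jacobian is the `d`-th power of the derivative norm, and distortion
bounds it from below. -/
theorem derivNorm_pow_mul_volume_le [Nontrivial (Euc d)] (hd : 0 < d) (ω : ∀ j, Φ.I j) (k n : ℕ)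
    {S : Set (Euc d)} (hS : MeasurableSet S) (hSX : S ⊆ X) :
    derivNorm X (Φ.seqMap ω k n) ^ d * volume S ≤
      (Φ.distConst : ℝ≥0∞) ^ d * volume (Φ.seqMap ω k n '' S) := by
  have hSV := hSX.trans Φ.subset_V
  rw [← lintegral_abs_det_fderiv_eq_addHaar_image volume hS
    (fun x hx => (Φ.seqMap_differentiableAt ω k n (hSV hx)).hasFDerivAt.hasFDerivWithinAt)
    ((Φ.seqMap_injOn ω k n).mono hSV), ← setLIntegral_const,
    ← lintegral_const_mul' _ _ (by simp)]
  refine setLIntegral_mono' hS fun x hx => ?_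
  rw [isConformalMap_abs_det hd (Φ.seqMap_isConformalMap ω k n (hSV hx)), ← mul_pow]
  gcongr
  exact Φ.derivNorm_le ω k n (hSV hx)

/-- The number of words of a given length, of derivative norm at least `r`, whose images of `X` meet
a given ball of radius `r` is bounded. -/
theorem exists_card_le [Nontrivial (Euc d)] (hd : 0 < d) (hX : IsPhaseSpace X) :
    ∃ M : ℝ≥0, ∀ (n : ℕ) (r : ℝ) (x : Euc d) (S : Finset (Φ.Word n)), 0 < r →
      (∀ τ ∈ S, ENNReal.ofReal r ≤ derivNorm X (Φ.map τ) ∧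
        ∃ q ∈ X, Φ.map τ q ∈ Metric.ball x r) → (S.card : ℝ≥0) ≤ M := by
  obtain ⟨c, l₀, hc, hl₀, hcork⟩ := hX.exists_corkscrew
  obtain ⟨δ, hδ, hδV⟩ := Φ.exists_ball_subset_V hX.isCompact
  -- With `l ≤ δ / 2`, balls of radius at most `l` around points of `X` stay inside `V`.
  set l := min l₀ (δ / 2) with hl
  have hl0 : 0 < l := lt_min hl₀ (by positivity)
  set K : ℝ := (Φ.distConst : ℝ) with hK
  have hK1 : 1 ≤ K := by exact_mod_cast Φ.one_le_distConst
  -- The constant compares the volume of a ball of radius `(1 + K l) r` with a lower bound for the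
  -- volume of one of the disjoint sets packed into it.
  refine ⟨((K * (1 + K * l) / (c * l)) ^ d).toNNReal, fun n r x S hr hS => ?_⟩
  have key : ∀ τ ∈ S, ∃ B : Set (Euc d), B ⊆ interior X ∧ MeasurableSet B ∧
      Φ.map τ '' B ⊆ Metric.ball x ((1 + K * l) * r) ∧
      ENNReal.ofReal ((c * l * r) ^ d) * volume (Metric.ball (0 : Euc d) 1) ≤
        ENNReal.ofReal (K ^ d) * volume (Φ.map τ '' B) := by
    intro τ hτ
    obtain ⟨hD, q, hq, hqx⟩ := hS τ hτ
    rw [Φ.map_eq_seqMap] at *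
    set f := Φ.seqMap (Φ.extend τ) 0 n with hf
    set D := (derivNorm X f).toReal with hDD
    have hDtop := Φ.derivNorm_ne_top hX.nonempty (Φ.extend τ) 0 n
    have hDr : r ≤ D := (ENNReal.ofReal_le_iff_le_toReal hDtop).1 hD
    have hD0 : 0 < D := hr.trans_le hDr
    -- At this scale the image of the ball of radius `s` around `q` has size comparable to `r`; `s ≤
    -- l` because `r ≤ D`.
    set s := l * r / D with hs
    have hs0 : 0 < s := by positivity
    have hsl : s ≤ l := by
      rw [hs, div_le_iff₀ hD0]
      gcongr
    obtain ⟨y, hy⟩ := hcork q hq s hs0 (hsl.trans (min_le_left _ _))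
    refine ⟨Metric.ball y (c * s), ?_, measurableSet_ball, ?_, ?_⟩
    · exact interior_maximal (hy.trans inter_subset_left) Metric.isOpen_ball
    · rintro _ ⟨w, hw, rfl⟩
      have hwq := mem_closedBall_iff_norm.1 (hy hw).2
      have hsδ : s < δ := hsl.trans_lt ((min_le_right _ _).trans_lt (by linarith))
      have h1 := Φ.norm_seqMap_sub_le hX.nonempty (Φ.extend τ) 0 n (convex_ball q δ) (hδV q hq)
        (Metric.mem_ball_self hδ) (mem_ball_iff_norm.2 (hwq.trans_lt hsδ))
      have h2 : K * D * ‖w - q‖ ≤ K * l * r := by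
        calc K * D * ‖w - q‖ ≤ K * D * s := by gcongr
          _ = K * l * r := by rw [hs]; field_simp
      have h3 := norm_sub_le_norm_sub_add_norm_sub (f w) (f q) x
      have h4 := mem_ball_iff_norm.1 hqx
      rw [mem_ball_iff_norm]
      linarith
    · have h1 := Φ.derivNorm_pow_mul_volume_le hd (Φ.extend τ) 0 n (S := Metric.ball y (c * s))
        measurableSet_ball (hy.trans inter_subset_left)
      rw [Measure.addHaar_ball volume y (by positivity : 0 ≤ c * s), ← mul_assoc,
        ← ENNReal.ofReal_toReal hDtop, ← ENNReal.ofReal_pow ENNReal.toReal_nonneg,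
        ← ENNReal.ofReal_mul (by positivity), finrank_euclideanSpace_fin, ← mul_pow,
        ← ENNReal.ofReal_coe_nnreal, ← ENNReal.ofReal_pow (by positivity)] at h1
      rwa [show c * l * r = D * (c * s) by rw [hs]; field_simp]
  choose! B hBX hBm hBb hBv using key
  have hdisj : (S : Set (Φ.Word n)).PairwiseDisjoint fun τ => Φ.map τ '' B τ := by
    intro τ hτ τ' hτ' hne
    have hne' : ∃ j < n, Φ.extend τ j ≠ Φ.extend τ' j := by
      by_contra! h
      exact hne (by rw [← Φ.initial_extend τ, ← Φ.initial_extend τ', Φ.initial_eq_iff.2 h])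
    have := Φ.seqMap_disjoint hne'
    rw [← Φ.map_eq_seqMap, ← Φ.map_eq_seqMap] at this
    exact this.mono (image_mono (hBX τ hτ)) (image_mono (hBX τ' hτ'))
  have hmeas : ∀ τ ∈ S, MeasurableSet (Φ.map τ '' B τ) := by
    intro τ hτ
    have hBV : B τ ⊆ X := (hBX τ hτ).trans interior_subset
    rw [Φ.map_eq_seqMap]
    exact (hBm τ hτ).image_of_continuousOn_injOn ((Φ.seqMap_continuousOn _ _ _).mono hBV)
      ((Φ.seqMap_injOn _ _ _).mono (hBV.trans Φ.subset_V))
  have hsum : (S.card : ℝ≥0∞) * (ENNReal.ofReal ((c * l * r) ^ d) *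
      volume (Metric.ball (0 : Euc d) 1)) ≤
      ENNReal.ofReal (K ^ d) * (ENNReal.ofReal (((1 + K * l) * r) ^ d) *
        volume (Metric.ball (0 : Euc d) 1)) := by
    calc _ = ∑ τ ∈ S, (ENNReal.ofReal ((c * l * r) ^ d) * volume (Metric.ball (0 : Euc d) 1)) := by
          rw [Finset.sum_const, nsmul_eq_mul]
      _ ≤ ∑ τ ∈ S, ENNReal.ofReal (K ^ d) * volume (Φ.map τ '' B τ) := Finset.sum_le_sum hBv
      _ = ENNReal.ofReal (K ^ d) * volume (⋃ τ ∈ S, Φ.map τ '' B τ) := by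
          rw [← Finset.mul_sum, measure_biUnion_finset hdisj hmeas]
      _ ≤ ENNReal.ofReal (K ^ d) * volume (Metric.ball x ((1 + K * l) * r)) := by
          gcongr
          exact iUnion₂_subset hBb
      _ = _ := by rw [Measure.addHaar_ball volume x (by positivity), finrank_euclideanSpace_fin]
  rw [← mul_assoc, ← mul_assoc, ENNReal.mul_le_mul_iff_left
    (Metric.measure_ball_pos _ _ one_pos).ne' measure_ball_lt_top.ne,
    ← ENNReal.ofReal_natCast, ← ENNReal.ofReal_mul (by positivity),
    ← ENNReal.ofReal_mul (by positivity), ENNReal.ofReal_le_ofReal_iff (by positivity)] at hsum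
  rw [Real.le_toNNReal_iff_coe_le (by positivity), NNReal.coe_natCast]
  rw [div_pow, le_div_iff₀ (by positivity)]
  have hrd : 0 < r ^ d := by positivity
  refine le_of_mul_le_mul_right ?_ hrd
  calc _ = (S.card : ℝ) * (c * l * r) ^ d := by rw [mul_pow]; ring
    _ ≤ _ := hsum
    _ = _ := by simp only [mul_pow]; ring

end NCIFS

/-! ### Exponential form of bounds on the pressure -/

namespace ENNReal

theorem log_ofReal_exp (x : ℝ) : ENNReal.log (ENNReal.ofReal (Real.exp x)) = x := by
  rw [ENNReal.log_ofReal, if_neg (by simpa using Real.exp_pos x), Real.log_exp]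

theorem log_div_natCast_lt_iff {z : ℝ≥0∞} {n : ℕ} (hn : 0 < n) (c : ℝ) :
    ENNReal.log z / (n : EReal) < (c : EReal) ↔ z < ENNReal.ofReal (Real.exp (c * n)) := by
  rw [EReal.div_lt_iff (by exact_mod_cast hn) (EReal.natCast_ne_top n),
    ← ENNReal.log_lt_log_iff, log_ofReal_exp]
  norm_cast

theorem lt_log_div_natCast_iff {z : ℝ≥0∞} {n : ℕ} (hn : 0 < n) (c : ℝ) :
    (c : EReal) < ENNReal.log z / (n : EReal) ↔ ENNReal.ofReal (Real.exp (c * n)) < z := by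
  rw [EReal.lt_div_iff (by exact_mod_cast hn) (EReal.natCast_ne_top n),
    ← ENNReal.log_lt_log_iff, log_ofReal_exp]
  norm_cast

end ENNReal

namespace NCIFS

variable {d : ℕ} {X : Set (Euc d)} (Φ : NCIFS X)

theorem Z_ne_zero [Nontrivial (Euc d)] (hX : X.Nonempty) (n : ℕ) (t : ℝ≥0) : Φ.Z n t ≠ 0 := by
  have ω : ∀ j, Φ.I j := fun j => Classical.choice (Φ.nonempty j)
  intro h
  rw [Z, ENNReal.tsum_eq_zero] at h
  exact (ENNReal.rpow_pos (pos_iff_ne_zero.2 (Φ.derivNorm_ne_zero hX ω 0 n))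
    (Φ.derivNorm_ne_top hX ω 0 n)).ne' (h (Φ.initial ω n))

theorem derivNorm_map_ne_top (hX : X.Nonempty) {n : ℕ} (ω : Φ.Word n) :
    derivNorm X (Φ.map ω) ≠ ⊤ := by
  rw [Φ.map_eq_seqMap]
  exact Φ.derivNorm_ne_top hX _ _ _

theorem Z_ne_top (hX : X.Nonempty) (hΦ : Φ.IsFinite) (n : ℕ) (t : ℝ≥0) : Φ.Z n t ≠ ⊤ := by
  have := Φ.finite_word hΦ n
  have := Fintype.ofFinite (Φ.Word n)
  rw [Z, tsum_fintype]
  exact (ENNReal.sum_lt_top.2 fun ω _ =>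
    (ENNReal.rpow_ne_top_of_nonneg t.2 (Φ.derivNorm_map_ne_top hX ω)).lt_top).ne

/-! ### Upper bound for the dimension of the limit set -/

section UpperBound

/-- With `q = η^(s-t) < 1`, contraction gives `‖Dφ_ω‖^s ≤ q^(n-1) ‖Dφ_ω‖^t`, while a pressure below
`-log q` gives `Z_n(t) < q^(-n)` infinitely often. The product of the two bounds does not depend on
`n`. -/
theorem hausdorffMeasure_limitSet_ne_top [Nontrivial (Euc d)] (hX : IsPhaseSpace X)
    (hΦ : Φ.IsFinite) {t s : ℝ≥0} (hts : t < s) (ht : ¬ 0 < Φ.lowerPressure t) :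
    μH[(s : ℝ)] Φ.limitSet ≠ ⊤ := by
  obtain ⟨η, hη0, hη1, m₀, hη⟩ := Φ.exists_derivNorm_le_pow
  obtain ⟨δ, hδ, hδV⟩ := Φ.exists_ball_subset_V hX.isCompact
  obtain ⟨F, hFX, hF⟩ := hX.isCompact.elim_nhds_subcover (fun x => Metric.ball x δ)
    fun x _ => Metric.ball_mem_nhds x hδ
  set q : ℝ≥0 := η ^ ((s : ℝ) - t) with hq
  have hst : 0 < (s : ℝ) - t := sub_pos.2 (NNReal.coe_lt_coe.2 hts)
  have hq0 : 0 < q := NNReal.rpow_pos hη0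
  have hq1 : q < 1 := NNReal.rpow_lt_one hη1 hst
  set c : ℝ := -Real.log q with hc
  have hc0 : 0 < c := by
    rw [hc, neg_pos]
    exact Real.log_neg (by exact_mod_cast hq0) (by exact_mod_cast hq1)
  have hcn : ∀ n : ℕ, ENNReal.ofReal (Real.exp (c * n)) = ((q : ℝ≥0∞)⁻¹) ^ n := by
    intro n
    rw [mul_comm, Real.exp_nat_mul, ENNReal.ofReal_pow (Real.exp_pos _).le, hc, Real.exp_neg,
      Real.exp_log (by exact_mod_cast hq0), ENNReal.ofReal_inv_of_pos (by exact_mod_cast hq0),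
      ENNReal.ofReal_coe_nnreal]
  set C : ℝ≥0∞ := Φ.distConst * ENNReal.ofReal (2 * δ) with hC
  have hCtop : C ≠ ⊤ := ENNReal.mul_ne_top ENNReal.coe_ne_top ENNReal.ofReal_ne_top
  have hs0 : (0 : ℝ) ≤ s := s.2
  -- `X` is cut by finitely many balls contained in `V`, on which the mean value inequality applies.
  let T : ∀ n : ℕ, Φ.Word n × F → Set (Euc d) := fun n p => Φ.map p.1 '' (X ∩ Metric.ball p.2 δ)
  have hdiam : ∀ n p, Metric.ediam (T n p) ≤ C * derivNorm X (Φ.map p.1) := by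
    rintro n ⟨ω, x⟩
    refine Metric.ediam_le ?_
    rintro _ ⟨a, ⟨-, ha⟩, rfl⟩ _ ⟨b, ⟨-, hb⟩, rfl⟩
    simp only
    have htop := Φ.derivNorm_map_ne_top hX.nonempty ω
    rw [Φ.map_eq_seqMap] at htop ⊢
    have h1 := Φ.norm_seqMap_sub_le hX.nonempty (Φ.extend ω) 0 n (convex_ball _ δ)
      (hδV x (hFX x x.2)) hb ha
    have h2 : ‖a - b‖ ≤ 2 * δ := by
      have := dist_triangle_right a b (x : Euc d)
      rw [dist_eq_norm] at this
      rw [Metric.mem_ball] at ha hb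
      linarith
    rw [edist_dist, dist_eq_norm]
    refine (ENNReal.ofReal_le_ofReal
      (h1.trans (mul_le_mul_of_nonneg_left h2 (by positivity)))).trans
      (le_of_eq ?_)
    rw [ENNReal.ofReal_mul (by positivity), ENNReal.ofReal_mul (by positivity),
      ENNReal.ofReal_toReal htop, ENNReal.ofReal_coe_nnreal, hC]
    ring
  have hsmall : ∀ᶠ n in atTop, ∀ ω : Φ.Word n,
      derivNorm X (Φ.map ω) ≤ (η : ℝ≥0∞) ^ (n - 1) := by
    filter_upwards [eventually_ge_atTop (m₀ + 1)] with n hn ω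
    obtain ⟨m, rfl⟩ := Nat.exists_eq_add_of_le' (show 1 ≤ n by omega)
    rw [Φ.map_eq_seqMap]
    exact hη m (by omega) _ 0
  have hη1' : (η : ℝ≥0∞) < 1 := by exact_mod_cast hη1
  have hlim : Tendsto (fun n : ℕ => C * (η : ℝ≥0∞) ^ (n - 1)) atTop (𝓝 0) := by
    rw [← mul_zero C]
    exact ENNReal.Tendsto.const_mul ((ENNReal.tendsto_pow_atTop_nhds_zero_of_lt_one hη1').comp
      (tendsto_sub_atTop_nat 1)) (Or.inr hCtop)
  have hcount : ∀ n, Countable (Φ.Word n × F) := fun n => by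
    have := Φ.finite_word hΦ n
    infer_instance
  have hμ := Measure.hausdorffMeasure_le_liminf_tsum (s : ℝ) Φ.limitSet _ hlim T
    (by
      filter_upwards [hsmall] with n hn p
      exact (hdiam n p).trans (by gcongr; exact hn p.1))
    (by
      refine Eventually.of_forall fun n x hx => ?_
      obtain ⟨ω, a, ha, rfl⟩ := mem_iUnion.1 (Φ.limitSet_subset n hx)
      obtain ⟨y, hy, hay⟩ := mem_iUnion₂.1 (hF ha)
      exact mem_iUnion.2 ⟨(ω, ⟨y, hy⟩), mem_image_of_mem _ ⟨ha, hay⟩⟩)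
  have hfreq : ∃ᶠ n : ℕ in atTop, Φ.Z n t < ENNReal.ofReal (Real.exp (c * n)) := by
    have h1 : Φ.lowerPressure t < (c : EReal) :=
      (not_lt.1 ht).trans_lt (by exact_mod_cast hc0)
    refine ((frequently_lt_of_liminf_lt (by isBoundedDefault) h1).and_eventually
      (eventually_gt_atTop 0)).mono fun n hn => ?_
    exact (ENNReal.log_div_natCast_lt_iff hn.2 c).1 hn.1
  set B : ℝ≥0∞ := F.card * (C ^ (s : ℝ) * (q : ℝ≥0∞)⁻¹) with hB
  have hBtop : B ≠ ⊤ := by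
    refine ENNReal.mul_ne_top (by simp) (ENNReal.mul_ne_top
      (ENNReal.rpow_ne_top_of_nonneg hs0 hCtop) ?_)
    simpa using hq0.ne'
  refine (hμ.trans_lt (lt_of_le_of_lt (b := B) ?_ hBtop.lt_top)).ne
  refine liminf_le_of_frequently_le ((hfreq.and_eventually
    (hsmall.and (eventually_ge_atTop 1))).mono fun n hn => ?_)
  obtain ⟨hZ, hDn, hn1⟩ := hn
  obtain ⟨m, rfl⟩ := Nat.exists_eq_add_of_le' hn1
  rw [Nat.add_sub_cancel] at hDn
  have hterm : ∀ ω : Φ.Word (m + 1), (C * derivNorm X (Φ.map ω)) ^ (s : ℝ) ≤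
      C ^ (s : ℝ) * (q : ℝ≥0∞) ^ m * derivNorm X (Φ.map ω) ^ (t : ℝ) := by
    intro ω
    rw [ENNReal.mul_rpow_of_nonneg _ _ hs0, mul_assoc]
    gcongr
    rcases eq_or_ne (derivNorm X (Φ.map ω)) 0 with h0 | h0
    · rw [h0, ENNReal.zero_rpow_of_pos (by linarith [t.2])]
      exact zero_le
    rw [show (s : ℝ) = (s - t) + t by ring,
      ENNReal.rpow_add _ _ h0 (Φ.derivNorm_map_ne_top hX.nonempty ω)]
    gcongr
    calc derivNorm X (Φ.map ω) ^ ((s : ℝ) - t) ≤ ((η : ℝ≥0∞) ^ m) ^ ((s : ℝ) - t) :=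
          ENNReal.rpow_le_rpow (hDn ω) hst.le
      _ = (q : ℝ≥0∞) ^ m := by
          rw [hq, ENNReal.coe_rpow_of_nonneg _ hst.le, ← ENNReal.rpow_natCast,
            ← ENNReal.rpow_natCast, ← ENNReal.rpow_mul, ← ENNReal.rpow_mul, mul_comm]
  calc ∑' p : Φ.Word (m + 1) × F, Metric.ediam (T (m + 1) p) ^ (s : ℝ)
      ≤ ∑' p : Φ.Word (m + 1) × F,
          C ^ (s : ℝ) * (q : ℝ≥0∞) ^ m * derivNorm X (Φ.map p.1) ^ (t : ℝ) :=
        ENNReal.tsum_le_tsum fun p =>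
          (ENNReal.rpow_le_rpow (hdiam _ p) hs0).trans (hterm p.1)
    _ = F.card * (C ^ (s : ℝ) * (q : ℝ≥0∞) ^ m * Φ.Z (m + 1) t) := by
        rw [ENNReal.tsum_prod', ENNReal.tsum_comm]
        dsimp only
        rw [ENNReal.tsum_const, ENNReal.tsum_mul_left, Z]
        simp
    _ ≤ F.card * (C ^ (s : ℝ) * (q : ℝ≥0∞) ^ m * ((q : ℝ≥0∞)⁻¹) ^ (m + 1)) := by
        rw [← hcn]
        gcongr
    _ = B := by
        have : (q : ℝ≥0∞) * (q : ℝ≥0∞)⁻¹ = 1 :=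
          ENNReal.mul_inv_cancel (by exact_mod_cast hq0.ne') ENNReal.coe_ne_top
        rw [hB, pow_succ, mul_assoc (C ^ (s : ℝ)), ← mul_assoc ((q : ℝ≥0∞) ^ m), ← mul_pow, this,
          one_pow, one_mul]

theorem dimH_limitSet_le_bowenDim [Nontrivial (Euc d)] (hX : IsPhaseSpace X) (hΦ : Φ.IsFinite) :
    dimH Φ.limitSet ≤ Φ.bowenDim := by
  refine le_of_forall_gt_imp_ge_of_dense fun b hb => ?_
  obtain ⟨s, hs1, hs2⟩ := ENNReal.lt_iff_exists_nnreal_btwn.1 hb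
  obtain ⟨t, ht1, ht2⟩ := ENNReal.lt_iff_exists_nnreal_btwn.1 hs1
  have ht : ¬ 0 < Φ.lowerPressure t := fun h =>
    ht1.not_ge (le_iSup₂ (f := fun (t : ℝ≥0) (_ : 0 < Φ.lowerPressure t) => (t : ℝ≥0∞)) t h)
  exact (dimH_le_of_hausdorffMeasure_ne_top
    (Φ.hausdorffMeasure_limitSet_ne_top hX hΦ (by exact_mod_cast ht2) ht)).trans hs2.le

end UpperBound

/-! ### Lower bound under sub-exponential growth -/

section LowerBound

/-- For some `c > 0`, eventually `Z_n(t) > e^(cn)`, while the `n`-th alphabet has at most `e^(cn/2)`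
letters. The growth hypothesis enters the proof only here. -/
theorem tsum_card_div_Z_ne_top [Nontrivial (Euc d)] (hX : X.Nonempty) (hΦ : Φ.IsFinite)
    (hg : Tendsto Φ.growth atTop (𝓝 0)) {t : ℝ≥0} (ht : 0 < Φ.lowerPressure t) :
    ∑' k : ℕ, (Nat.card (Φ.I k) : ℝ≥0∞) / Φ.Z (k + 1) t ≠ ⊤ := by
  obtain ⟨c, hc0, hc⟩ := EReal.lt_iff_exists_real_btwn.1 ht
  have hc0 : 0 < c := by exact_mod_cast hc0
  have hZ : ∀ᶠ n : ℕ in atTop, ENNReal.ofReal (Real.exp (c * n)) < Φ.Z n t := by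
    filter_upwards [eventually_lt_of_lt_liminf hc (by isBoundedDefault), eventually_gt_atTop 0]
      with n hn hn0
    exact (ENNReal.lt_log_div_natCast_iff hn0 c).1 hn
  have hI : ∀ᶠ n : ℕ in atTop, (Nat.card (Φ.I n) : ℝ) ≤ Real.exp (c / 2 * (n + 1)) := by
    filter_upwards [hg.eventually_lt_const (half_pos hc0)] with n hn
    have := hΦ n
    have := Φ.nonempty n
    have hpos : (0 : ℝ) < Nat.card (Φ.I n) := by exact_mod_cast Nat.card_pos
    rw [growth, div_lt_iff₀ (by positivity)] at hn
    rw [← Real.log_le_iff_le_exp hpos]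
    exact hn.le
  have hev : ∀ᶠ k : ℕ in atTop, (Nat.card (Φ.I k) : ℝ≥0∞) / Φ.Z (k + 1) t ≤
      ENNReal.ofReal (Real.exp (-(c / 2)) ^ k) := by
    filter_upwards [hI, (tendsto_add_atTop_nat 1).eventually hZ] with k hk1 hk2
    calc (Nat.card (Φ.I k) : ℝ≥0∞) / Φ.Z (k + 1) t
        ≤ ENNReal.ofReal (Real.exp (c / 2 * (k + 1))) /
            ENNReal.ofReal (Real.exp (c * (k + 1 : ℕ))) := by
          rw [← ENNReal.ofReal_natCast]
          gcongr
      _ ≤ ENNReal.ofReal (Real.exp (-(c / 2)) ^ k) := by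
          rw [← ENNReal.ofReal_div_of_pos (Real.exp_pos _), ← Real.exp_sub, ← Real.exp_nat_mul]
          refine ENNReal.ofReal_le_ofReal (Real.exp_le_exp.2 ?_)
          push_cast
          nlinarith
  obtain ⟨N, hN⟩ := eventually_atTop.1 hev
  rw [← ENNReal.summable.sum_add_tsum_nat_add' (k := N)]
  refine ENNReal.add_ne_top.2 ⟨(ENNReal.sum_lt_top.2 fun k _ => ?_).ne, ne_top_of_le_ne_top ?_
    (ENNReal.tsum_le_tsum fun k => hN (k + N) (by omega))⟩
  · exact ENNReal.div_lt_top (by simp) (Φ.Z_ne_zero hX _ _)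
  · refine Summable.tsum_ofReal_ne_top ((summable_nat_add_iff N).2
      (summable_geometric_of_lt_one (Real.exp_pos _).le ?_))
    rw [Real.exp_lt_one_iff]
    linarith

theorem eventually_derivNorm_lt {r : ℝ} (hr : 0 < r) :
    ∀ᶠ n in atTop, ∀ ω : Φ.Word n, derivNorm X (Φ.map ω) < ENNReal.ofReal r := by
  obtain ⟨η, hη0, hη1, m₀, hη⟩ := Φ.exists_derivNorm_le_pow
  have hη1' : (η : ℝ≥0∞) < 1 := by exact_mod_cast hη1
  have h1 := ((ENNReal.tendsto_pow_atTop_nhds_zero_of_lt_one hη1').comp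
    (tendsto_sub_atTop_nat 1)).eventually_lt_const (ENNReal.ofReal_pos.2 hr)
  filter_upwards [h1, eventually_ge_atTop (m₀ + 1)] with n hn1 hn ω
  obtain ⟨m, rfl⟩ := Nat.exists_eq_add_of_le' (show 1 ≤ n by omega)
  rw [Φ.map_eq_seqMap]
  exact (hη m (by omega) _ 0).trans_lt hn1

theorem bowenDim_le_dimH_limitSet [Nontrivial (Euc d)] (hd : 0 < d) (hX : IsPhaseSpace X)
    (hΦ : Φ.IsFinite) (hg : Tendsto Φ.growth atTop (𝓝 0)) :
    Φ.bowenDim ≤ dimH Φ.limitSet := by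
  refine iSup₂_le fun t ht => ?_
  obtain ⟨M, hM⟩ := Φ.exists_card_le hd hX
  obtain ⟨p, hp⟩ := hX.nonempty
  have ht0 : (0 : ℝ) ≤ t := t.2
  set A := ∑' k : ℕ, (Nat.card (Φ.I k) : ℝ≥0∞) / Φ.Z (k + 1) t with hA
  have hAtop : A ≠ ⊤ := Φ.tsum_card_div_Z_ne_top hX.nonempty hΦ hg ht
  set K : ℝ≥0∞ := (Φ.distConst : ℝ≥0∞) ^ (t : ℝ) with hK
  have hKtop : K ≠ ⊤ := ENNReal.rpow_ne_top_of_nonneg ht0 ENNReal.coe_ne_top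
  have hCtop : M * K * A ≠ ⊤ :=
    ENNReal.mul_ne_top (ENNReal.mul_ne_top ENNReal.coe_ne_top hKtop) hAtop
  have hZ0 := fun n => Φ.Z_ne_zero hX.nonempty n t
  have hZtop := fun n => Φ.Z_ne_top hX.nonempty hΦ n t
  refine Φ.le_dimH_limitSet_of_weights hX.isCompact hΦ hp
    (fun n ω => derivNorm X (Φ.map ω) ^ (t : ℝ) / Φ.Z n t) (Eventually.of_forall fun n => ?_)
    (C := (M * K * A).toNNReal) one_pos fun r hr hr1 => ?_
  · simp_rw [div_eq_mul_inv]
    rw [ENNReal.tsum_mul_right, ← Z, ENNReal.mul_inv_cancel (hZ0 n) (hZtop n)]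
  filter_upwards [Φ.eventually_derivNorm_lt hr] with n hn x
  rw [ENNReal.coe_toNNReal hCtop]
  set R := ENNReal.ofReal r
  -- `S k` consists of the prefixes that are not yet small and whose images meet the ball; `T k` of
  -- the words that are stopped at length `k + 1` after such a prefix.
  let S : ∀ k, Set (Φ.Word k) := fun k =>
    {σ | R ≤ derivNorm X (Φ.map σ) ∧ ∃ q ∈ X, Φ.map σ q ∈ Metric.ball x r}
  let T : ∀ k, Set (Φ.Word (k + 1)) := fun k =>
    {τ | derivNorm X (Φ.map τ) < R ∧ Φ.initial (Φ.extend τ) k ∈ S k}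
  have hS : ∀ k (b : ℝ≥0∞), ∑' _ : S k, b ≤ M * b := by
    intro k b
    have := Φ.finite_word hΦ k
    rw [ENNReal.tsum_set_const]
    have h1 := hM k r x (S k).toFinite.toFinset hr (fun τ hτ => by simpa [S] using hτ)
    rw [(S k).toFinite.encard_eq_coe_toFinset_card]
    gcongr
    exact ENNReal.coe_le_coe.2 h1
  have hT : ∀ k (b : ℝ≥0∞), ∑' _ : T k, b ≤ M * (Nat.card (Φ.I k) * b) := by
    intro k b
    have := hΦ k
    let G : T k → S k × Φ.I k := fun τ => (⟨_, τ.2.2⟩, Φ.extend τ.1 k)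
    have hG : Function.Injective G := by
      rintro ⟨τ, hτ⟩ ⟨τ', hτ'⟩ h
      simp only [G, Prod.mk.injEq, Subtype.mk.injEq] at h
      have h1 := Φ.initial_eq_iff.1 h.1
      rw [Subtype.mk.injEq, ← Φ.initial_extend τ, ← Φ.initial_extend τ', initial_eq_iff]
      intro j hj
      rcases Nat.lt_succ_iff_lt_or_eq.1 hj with hj | rfl
      · exact h1 j hj
      · exact h.2
    calc ∑' _ : T k, b ≤ ∑' _ : S k × Φ.I k, b :=
          ENNReal.tsum_comp_le_tsum_of_injective hG fun _ => b
      _ = ∑' _ : S k, Nat.card (Φ.I k) * b := by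
          rw [ENNReal.tsum_prod']
          simp_rw [ENNReal.tsum_const, ENat.card_eq_coe_natCard]
          simp
      _ ≤ _ := hS k _
  have hcyl : ∀ k < n, ∀ τ ∈ T k,
      ∑' ω : Φ.cylinder τ n, derivNorm X (Φ.map ω.1) ^ (t : ℝ) / Φ.Z n t ≤
        K * R ^ (t : ℝ) / Φ.Z (k + 1) t := by
    intro k hk τ hτ
    have h1 := Φ.tsum_cylinder_mul_Z_le t (Nat.succ_le_of_lt hk) τ
    simp_rw [div_eq_mul_inv (_ ^ (t : ℝ))]
    rw [ENNReal.tsum_mul_right, ← div_eq_mul_inv,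
      ENNReal.div_le_iff_le_mul (Or.inl (hZ0 n)) (Or.inl (hZtop n)), div_eq_mul_inv,
      mul_right_comm, ← div_eq_mul_inv,
      ENNReal.le_div_iff_mul_le (Or.inl (hZ0 _)) (Or.inl (hZtop _))]
    refine h1.trans ?_
    gcongr
    exact hτ.1.le
  have hsub : {ω : Φ.Word n | Φ.map ω p ∈ Metric.ball x r} ⊆
      ⋃ k : Fin n, ⋃ τ : T k, Φ.cylinder τ.1 n := by
    intro ω hω
    have hex : ∃ k, derivNorm X (Φ.seqMap (Φ.extend ω) 0 k) < R := ⟨n, by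
      rw [← Φ.map_eq_seqMap]; exact hn ω⟩
    classical
    have hle : Nat.find hex ≤ n := Nat.find_min' hex (by rw [← Φ.map_eq_seqMap]; exact hn ω)
    have hlt := Nat.find_spec hex
    -- The empty word has norm `1 > r`, so the stopping time is positive.
    obtain ⟨k, hk⟩ : ∃ k, Nat.find hex = k + 1 := by
      refine Nat.exists_eq_succ_of_ne_zero fun h0 => ?_
      rw [h0, seqMap_zero, derivNorm_id hX.nonempty, ← ENNReal.ofReal_one,
        ENNReal.ofReal_lt_ofReal_iff hr] at hlt
      linarith
    rw [hk] at hlt hle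
    have hge := not_lt.1 (Nat.find_min hex (show k < Nat.find hex by omega))
    have hini : Φ.initial (Φ.extend (Φ.initial (Φ.extend ω) (k + 1))) k =
        Φ.initial (Φ.extend ω) k :=
      Φ.initial_eq_iff.2 fun j hj => Φ.extend_apply (Φ.initial (Φ.extend ω) (k + 1)) ⟨j, by omega⟩
    refine mem_iUnion₂.2 ⟨⟨k, hle⟩, ⟨Φ.initial (Φ.extend ω) (k + 1), hlt, ?_⟩, rfl⟩
    rw [hini]
    refine ⟨hge, Φ.seqMap (Φ.extend ω) (0 + k) (n - k) p, Φ.seqMap_mapsTo _ _ _ hp, ?_⟩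
    have h1 := Φ.seqMap_add (Φ.extend ω) 0 k (n - k)
    rw [Nat.add_sub_cancel' (by omega), ← Φ.map_eq_seqMap] at h1
    rw [map_initial, ← Function.comp_apply (f := Φ.seqMap (Φ.extend ω) 0 k), ← h1]
    exact hω
  set w : Φ.Word n → ℝ≥0∞ := fun ω => derivNorm X (Φ.map ω) ^ (t : ℝ) / Φ.Z n t with hw
  calc ∑' ω : {ω : Φ.Word n | Φ.map ω p ∈ Metric.ball x r}, w ω
      ≤ ∑' ω : (⋃ k : Fin n, ⋃ τ : T k, Φ.cylinder τ.1 n : Set (Φ.Word n)), w ω :=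
        ENNReal.tsum_mono_subtype w hsub
    _ ≤ ∑' k : Fin n, ∑' ω : (⋃ τ : T k, Φ.cylinder τ.1 n : Set (Φ.Word n)), w ω :=
        ENNReal.tsum_iUnion_le_tsum w _
    _ ≤ ∑' k : Fin n, ∑' τ : T k, ∑' ω : Φ.cylinder τ.1 n, w ω :=
        ENNReal.tsum_le_tsum fun k => ENNReal.tsum_iUnion_le_tsum w _
    _ ≤ ∑' k : Fin n, ∑' τ : T k, K * R ^ (t : ℝ) / Φ.Z (k + 1) t :=
        ENNReal.tsum_le_tsum fun k => ENNReal.tsum_le_tsum fun τ => hcyl k k.2 τ.1 τ.2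
    _ ≤ ∑' k : Fin n, M * (Nat.card (Φ.I k) * (K * R ^ (t : ℝ) / Φ.Z (k + 1) t)) :=
        ENNReal.tsum_le_tsum fun k => hT k _
    _ ≤ ∑' k : ℕ, M * (Nat.card (Φ.I k) * (K * R ^ (t : ℝ) / Φ.Z (k + 1) t)) :=
        ENNReal.tsum_comp_le_tsum_of_injective Fin.val_injective
          fun k : ℕ => M * (Nat.card (Φ.I k) * (K * R ^ (t : ℝ) / Φ.Z (k + 1) t))
    _ = ∑' k : ℕ, (M * K * R ^ (t : ℝ)) * (Nat.card (Φ.I k) / Φ.Z (k + 1) t) := by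
        congr 1
        funext k
        simp only [div_eq_mul_inv]
        ring
    _ = M * K * A * R ^ (t : ℝ) := by
        rw [ENNReal.tsum_mul_left, ← hA]
        ring

end LowerBound

end NCIFS

/-! ### Homotheties whose images form cubic grids -/

/-- The point with integer coordinates `v`. -/
def gridVec {d M : ℕ} (v : Fin d → Fin M) : Euc d := WithLp.toLp 2 fun i => ((v i : ℕ) : ℝ)

theorem gridVec_apply {d M : ℕ} (v : Fin d → Fin M) (i : Fin d) : gridVec v i = (v i : ℕ) := rfl

theorem abs_sub_le_norm_gridVec_sub {d M : ℕ} (v w : Fin d → Fin M) (i : Fin d) :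
    |((v i : ℕ) : ℝ) - (w i : ℕ)| ≤ ‖gridVec v - gridVec w‖ :=
  PiLp.norm_apply_le (gridVec v - gridVec w) i

theorem one_le_norm_gridVec_sub {d M : ℕ} {v w : Fin d → Fin M} (h : v ≠ w) :
    1 ≤ ‖gridVec v - gridVec w‖ := by
  obtain ⟨i, hi⟩ := Function.ne_iff.1 h
  refine le_trans ?_ (abs_sub_le_norm_gridVec_sub v w i)
  have h1 : ((v i : ℕ) : ℤ) - (w i : ℕ) ≠ 0 := by
    rw [sub_ne_zero]
    exact_mod_cast fun h => hi (Fin.ext h)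
  exact_mod_cast Int.one_le_abs h1

theorem norm_le_of_abs_le {d : ℕ} {x : Euc d} {c : ℝ} (hc : 0 ≤ c) (h : ∀ i, |x i| ≤ c) :
    ‖x‖ ≤ d * c := by
  refine abs_le_of_sq_le_sq' ?_ (by positivity) |>.2
  rw [EuclideanSpace.norm_sq_eq]
  calc ∑ i, ‖x i‖ ^ 2 ≤ ∑ _i : Fin d, c ^ 2 :=
        Finset.sum_le_sum fun i _ => pow_le_pow_left₀ (norm_nonneg _) (h i) 2
    _ = d * c ^ 2 := by simp
    _ ≤ (d * c) ^ 2 := by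
        rw [mul_pow]
        gcongr
        exact_mod_cast Nat.le_self_pow two_ne_zero d

theorem norm_gridVec_sub_le {d M : ℕ} (v w : Fin d → Fin M) :
    ‖gridVec v - gridVec w‖ ≤ d * M := by
  refine norm_le_of_abs_le (by positivity) fun i => ?_
  rw [PiLp.sub_apply, gridVec_apply, gridVec_apply, abs_le]
  have h1 : ((v i : ℕ) : ℝ) < M := by exact_mod_cast (v i).2
  have h2 : ((w i : ℕ) : ℝ) < M := by exact_mod_cast (w i).2
  have h3 : (0 : ℝ) ≤ (v i : ℕ) := by positivity
  have h4 : (0 : ℝ) ≤ (w i : ℕ) := by positivity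
  constructor <;> linarith

theorem norm_gridVec_le {d M : ℕ} (v : Fin d → Fin M) : ‖gridVec v‖ ≤ d * M := by
  refine norm_le_of_abs_le (by positivity) fun i => ?_
  rw [gridVec_apply, abs_of_nonneg (by positivity)]
  exact Nat.cast_le.2 (v i).2.le

theorem hasFDerivAt_smul_add {d : ℕ} (c : ℝ) (b x : Euc d) :
    HasFDerivAt (fun x : Euc d => c • x + b) (c • ContinuousLinearMap.id ℝ (Euc d)) x :=
  ((hasFDerivAt_id (𝕜 := ℝ) x).const_smul c).add_const b

/-- The parameters of a system of homotheties: at stage `n` there are `M n ^ d` maps of ratio `r n`,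
and the images of the base point `z` form a cubic grid of mesh `δ n`. -/
structure GridData {d : ℕ} (X : Set (Euc d)) where
  z : Euc d
  R : ℝ
  D : ℝ
  M : ℕ → ℕ
  r : ℕ → ℝ
  δ : ℕ → ℝ
  η : ℝ
  convex : Convex ℝ X
  R_pos : 0 < R
  R_le_D : R ≤ D
  ball_subset : Metric.closedBall z R ⊆ X
  norm_sub_le : ∀ x ∈ X, ∀ y ∈ X, ‖x - y‖ ≤ D
  M_pos : ∀ n, 0 < M n
  r_pos : ∀ n, 0 < r n
  r_le : ∀ n, r n ≤ η
  η_lt_one : η < 1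
  δ_pos : ∀ n, 0 < δ n
  -- Puts the fixed point `z + (δ / (1 - r)) • gridVec v` of each map into the ball around `z`, so
  -- that convexity keeps `X` invariant. For a single map `gridVec v = 0` and nothing is required.
  mesh_le : ∀ n, 1 < M n → d * (δ n * M n) ≤ (1 - r n) * R
  -- Images have diameter at most half the mesh, so grid positions determine distances up to a
  -- bounded factor.
  ratio_le : ∀ n, 1 < M n → r n * D ≤ δ n / 2

namespace GridData

variable {d : ℕ} {X : Set (Euc d)} (G : GridData X)

theorem z_mem : G.z ∈ X := G.ball_subset (Metric.mem_closedBall_self G.R_pos.le)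

theorem r_lt_one (n : ℕ) : G.r n < 1 := (G.r_le n).trans_lt G.η_lt_one

theorem one_lt_M {n : ℕ} {v w : Fin d → Fin (G.M n)} (h : v ≠ w) : 1 < G.M n := by
  obtain ⟨i, hi⟩ := Function.ne_iff.1 h
  have h1 := (v i).2
  have h2 := (w i).2
  have h3 : ((v i : ℕ)) ≠ w i := fun h => hi (Fin.ext h)
  omega

/-- The maps of the system. -/
def gridMap (n : ℕ) (v : Fin d → Fin (G.M n)) (x : Euc d) : Euc d :=
  G.r n • x + (G.δ n • gridVec v + (1 - G.r n) • G.z)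

theorem gridMap_sub (n : ℕ) (v w : Fin d → Fin (G.M n)) (x y : Euc d) :
    G.gridMap n v x - G.gridMap n w y =
      G.r n • (x - y) + G.δ n • (gridVec v - gridVec w) := by
  unfold gridMap
  module

theorem gridMap_mapsTo (n : ℕ) (v : Fin d → Fin (G.M n)) : MapsTo (G.gridMap n v) X X := by
  intro x hx
  have h1 := G.r_lt_one n
  set c := G.z + (G.δ n / (1 - G.r n)) • gridVec v with hc
  have hcX : c ∈ X := by
    refine G.ball_subset ?_
    rw [mem_closedBall_iff_norm, hc, add_sub_cancel_left, norm_smul, Real.norm_of_nonneg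
      (div_nonneg (G.δ_pos n).le (by linarith)), div_mul_eq_mul_div, div_le_iff₀ (by linarith)]
    rcases (Nat.succ_le_of_lt (G.M_pos n)).eq_or_lt with hM | hM
    · have hv : ‖gridVec v‖ = 0 := by
        rw [norm_eq_zero]
        ext i
        have := (v i).2
        rw [gridVec_apply, show ((v i : ℕ)) = 0 by omega]
        simp
      rw [hv, mul_zero]
      exact mul_nonneg G.R_pos.le (by linarith)
    · have h2 := G.mesh_le n hM
      have h3 := mul_le_mul_of_nonneg_left (norm_gridVec_le v) (G.δ_pos n).le
      nlinarith
  have he : G.gridMap n v x = G.r n • x + (1 - G.r n) • c := by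
    rw [hc, smul_add, smul_smul, mul_div_cancel₀ _ (by linarith), gridMap]
    module
  rw [he]
  exact G.convex hx hcX (G.r_pos n).le (by linarith) (by ring)

/-- The ratio of the compositions of `n` maps. -/
def ratio (n : ℕ) : ℝ := ∏ j ∈ Finset.range n, G.r j

theorem ratio_succ (n : ℕ) : G.ratio (n + 1) = G.ratio n * G.r n := Finset.prod_range_succ _ _

theorem ratio_pos (n : ℕ) : 0 < G.ratio n := Finset.prod_pos fun j _ => G.r_pos j

theorem ratio_antitone : Antitone G.ratio := antitone_nat_of_succ_le fun n => by
  rw [ratio_succ]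
  exact mul_le_of_le_one_right (G.ratio_pos n).le (G.r_lt_one n).le

theorem exists_wordMap_eq (k n : ℕ) (ω : ∀ j : Fin n, Fin d → Fin (G.M (j + k))) :
    ∃ b, wordMap G.gridMap k n ω = fun x => (∏ j ∈ Finset.range n, G.r (j + k)) • x + b := by
  induction n with
  | zero => exact ⟨0, by funext x; simp [wordMap]⟩
  | succ n ih =>
    obtain ⟨b, hb⟩ := ih fun j => ω j.castSucc
    refine ⟨(∏ j ∈ Finset.range n, G.r (j + k)) • (G.δ (n + k) • gridVec (ω (Fin.last n)) +
      (1 - G.r (n + k)) • G.z) + b, ?_⟩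
    funext x
    rw [wordMap, Function.comp_apply, hb, Finset.prod_range_succ, gridMap]
    dsimp only
    module

theorem hasFDerivAt_wordMap (k n : ℕ) (ω : ∀ j : Fin n, Fin d → Fin (G.M (j + k))) (x : Euc d) :
    HasFDerivAt (wordMap G.gridMap k n ω)
      ((∏ j ∈ Finset.range n, G.r (j + k)) • ContinuousLinearMap.id ℝ (Euc d)) x := by
  obtain ⟨b, hb⟩ := G.exists_wordMap_eq k n ω
  rw [hb]
  exact hasFDerivAt_smul_add _ b x

/-- The system of homotheties. -/
def system : NCIFS X where
  I n := Fin d → Fin (G.M n)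
  countable _ := inferInstance
  nonempty n := ⟨fun _ => ⟨0, G.M_pos n⟩⟩
  φ := G.gridMap
  mapsTo := G.gridMap_mapsTo
  openSet n v w hvw := by
    rw [Set.disjoint_left]
    rintro _ ⟨x, hx, rfl⟩ ⟨y, hy, hxy⟩
    have h1 := G.gridMap_sub n v w x y
    rw [hxy, sub_self] at h1
    have h2 : ‖G.δ n • (gridVec v - gridVec w)‖ = ‖G.r n • (x - y)‖ := by
      rw [← norm_neg (G.r n • (x - y)), neg_eq_of_add_eq_zero_right h1.symm]
    rw [norm_smul, norm_smul, Real.norm_of_nonneg (G.δ_pos n).le,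
      Real.norm_of_nonneg (G.r_pos n).le] at h2
    have h3 := mul_le_mul_of_nonneg_left (one_le_norm_gridVec_sub hvw) (G.δ_pos n).le
    have h4 := mul_le_mul_of_nonneg_left
      (G.norm_sub_le x (interior_subset hx) y (interior_subset hy)) (G.r_pos n).le
    have h5 := G.ratio_le n (G.one_lt_M hvw)
    have h6 := G.δ_pos n
    linarith
  V := univ
  isOpen_V := isOpen_univ
  isConnected_V := isConnected_univ
  subset_V := subset_univ X
  mapsTo_V _ _ := mapsTo_univ _ _
  injOn_V n v x _ y _ hxy := by
    have h1 := G.gridMap_sub n v v x y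
    rw [hxy, sub_self, sub_self, smul_zero, add_zero] at h1
    exact sub_eq_zero.1 ((smul_eq_zero.1 h1.symm).resolve_left (G.r_pos n).ne')
  contDiffOn_V n v := ((contDiff_id.const_smul _).add contDiff_const).contDiffOn
  conformalAt_V n v x _ :=
    ⟨_, hasFDerivAt_smul_add _ _ x, isConformalMap_const_smul (G.r_pos n).ne'⟩
  distortion := ⟨1, le_rfl, fun k n ω x _ y _ => by
    rw [(G.hasFDerivAt_wordMap k n ω x).fderiv, (G.hasFDerivAt_wordMap k n ω y).fderiv, one_mul]⟩
  contraction := by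
    have hη : 0 < G.η := (G.r_pos 0).trans_le (G.r_le 0)
    refine ⟨G.η, hη, G.η_lt_one, 0, fun m _ k ω x _ => ?_⟩
    rw [(G.hasFDerivAt_wordMap k (m + 1) ω x).fderiv, norm_smul,
      Real.norm_of_nonneg (Finset.prod_nonneg fun j _ => (G.r_pos _).le)]
    calc (∏ j ∈ Finset.range (m + 1), G.r (j + k)) * ‖ContinuousLinearMap.id ℝ (Euc d)‖
        ≤ (∏ _j ∈ Finset.range (m + 1), G.η) * 1 := by
          refine mul_le_mul (Finset.prod_le_prod (fun j _ => (G.r_pos _).le) fun j _ => G.r_le _)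
            ContinuousLinearMap.norm_id_le (norm_nonneg _) (Finset.prod_nonneg fun _ _ => hη.le)
      _ = G.η ^ (m + 1) := by simp
      _ ≤ G.η ^ m := pow_le_pow_of_le_one hη.le G.η_lt_one.le (Nat.le_succ m)

theorem system_isFinite : G.system.IsFinite := fun n =>
  inferInstanceAs (Finite (Fin d → Fin (G.M n)))

theorem derivNorm_wordMap [Nontrivial (Euc d)] (k n : ℕ)
    (ω : ∀ j : Fin n, Fin d → Fin (G.M (j + k))) :
    derivNorm X (wordMap G.gridMap k n ω) =
      ENNReal.ofReal (∏ j ∈ Finset.range n, G.r (j + k)) := by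
  have : Nonempty X := ⟨⟨_, G.z_mem⟩⟩
  have h : ∀ x, ‖fderiv ℝ (wordMap G.gridMap k n ω) x‖ₑ =
      ENNReal.ofReal (∏ j ∈ Finset.range n, G.r (j + k)) := fun x => by
    rw [(G.hasFDerivAt_wordMap k n ω x).fderiv, ← ofReal_norm, norm_smul,
      ContinuousLinearMap.norm_id, mul_one,
      Real.norm_of_nonneg (Finset.prod_nonneg fun j _ => (G.r_pos _).le)]
  simp_rw [derivNorm, h, iSup_subtype', ciSup_const]

theorem derivNorm_map [Nontrivial (Euc d)] {n : ℕ} (ω : G.system.Word n) :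
    derivNorm X (G.system.map ω) = ENNReal.ofReal (G.ratio n) :=
  G.derivNorm_wordMap 0 n ω

theorem derivNorm_gridMap [Nontrivial (Euc d)] (n : ℕ) (v : Fin d → Fin (G.M n)) :
    derivNorm X (G.gridMap n v) = ENNReal.ofReal (G.r n) := by
  have : Nonempty X := ⟨⟨_, G.z_mem⟩⟩
  have h : ∀ x, ‖fderiv ℝ (G.gridMap n v) x‖ₑ = ENNReal.ofReal (G.r n) := fun x => by
    have h1 : HasFDerivAt (G.gridMap n v) (G.r n • ContinuousLinearMap.id ℝ (Euc d)) x :=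
      hasFDerivAt_smul_add _ _ x
    rw [h1.fderiv, ← ofReal_norm, norm_smul, ContinuousLinearMap.norm_id, mul_one,
      Real.norm_of_nonneg (G.r_pos n).le]
  simp_rw [derivNorm, h, iSup_subtype', ciSup_const]

theorem system_perfectlyBalanced [Nontrivial (Euc d)] : G.system.PerfectlyBalanced := by
  refine ⟨fun n => ?_, fun n v => ⟨G.r n, LinearIsometryEquiv.refl ℝ _, _, G.r_pos n,
    fun x _ => rfl⟩⟩
  have := G.system.nonempty n
  have h : ∀ v, derivNorm X (G.system.φ n v) = ENNReal.ofReal (G.r n) := G.derivNorm_gridMap n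
  simp_rw [NCIFS.rho, h]
  rw [ENNReal.div_self (ENNReal.ofReal_pos.2 (G.r_pos n)).ne' ENNReal.ofReal_ne_top]
  simp

/-- The number of words of length `n`. -/
def count (n : ℕ) : ℕ := ∏ j ∈ Finset.range n, G.M j ^ d

theorem count_succ (n : ℕ) : G.count (n + 1) = G.count n * G.M n ^ d := Finset.prod_range_succ _ _

theorem count_pos (n : ℕ) : 0 < G.count n := Finset.prod_pos fun j _ => pow_pos (G.M_pos j) d

theorem card_word (n : ℕ) : Nat.card (G.system.Word n) = G.count n := by
  have : Nat.card (∀ j : Fin n, Fin d → Fin (G.M j)) = G.count n := by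
    rw [Nat.card_pi, count, Finset.prod_range]
    simp
  exact this

theorem Z_eq [Nontrivial (Euc d)] (n : ℕ) (t : ℝ≥0) :
    G.system.Z n t = ENNReal.ofReal (G.count n * G.ratio n ^ (t : ℝ)) := by
  have := G.system.finite_word G.system_isFinite n
  simp_rw [NCIFS.Z, G.derivNorm_map]
  rw [ENNReal.tsum_const, ENat.card_eq_coe_natCard, card_word,
    ENNReal.ofReal_mul (by positivity), ENNReal.ofReal_rpow_of_pos (G.ratio_pos n)]
  simp

end GridData

/-! ### Hausdorff dimension of a grid system with isolated branching stages -/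

namespace GridData

variable {d : ℕ} {X : Set (Euc d)} (G : GridData X)

theorem seqMap_sub (ω : ∀ j, G.system.I j) (n : ℕ) (x y : Euc d) :
    G.system.seqMap ω 0 n x - G.system.seqMap ω 0 n y = G.ratio n • (x - y) := by
  obtain ⟨b, hb⟩ := G.exists_wordMap_eq 0 n fun j => ω (j + 0)
  have h : G.system.seqMap ω 0 n = fun x => G.ratio n • x + b := hb
  rw [h, add_sub_add_right_eq_sub, smul_sub]

theorem seqMap_succ_sub {ω ω' : ∀ j, G.system.I j} {n : ℕ} (h : ∀ j < n, ω j = ω' j)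
    (x y : Euc d) :
    G.system.seqMap ω 0 (n + 1) x - G.system.seqMap ω' 0 (n + 1) y =
      G.ratio n • (G.r n • (x - y) + G.δ n • (gridVec (ω n) - gridVec (ω' n))) := by
  rw [NCIFS.seqMap_succ, NCIFS.seqMap_succ, G.system.seqMap_congr (ω := ω) (ω' := ω')
    fun i _ hi => h i (by omega), Function.comp_apply, Function.comp_apply, seqMap_sub]
  congr 1
  exact G.gridMap_sub n (ω n) (ω' n) x y

theorem exists_seqMap_sub {ω ω' : ∀ j, G.system.I j} {j n : ℕ} (hjn : j < n)
    (h : ∀ i < j, ω i = ω' i) {p : Euc d} (hp : p ∈ X) : ∃ x ∈ X, ∃ y ∈ X,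
    G.system.seqMap ω 0 n p - G.system.seqMap ω' 0 n p =
      G.ratio j • (G.r j • (x - y) + G.δ j • (gridVec (ω j) - gridVec (ω' j))) := by
  obtain ⟨m, rfl⟩ := Nat.exists_eq_add_of_lt hjn
  refine ⟨_, G.system.seqMap_mapsTo ω (0 + (j + 1)) m hp, _,
    G.system.seqMap_mapsTo ω' (0 + (j + 1)) m hp, ?_⟩
  rw [← G.seqMap_succ_sub h, show j + m + 1 = j + 1 + m by omega,
    G.system.seqMap_add ω 0 (j + 1) m, G.system.seqMap_add ω' 0 (j + 1) m]
  rfl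

theorem norm_smul_sub_le (j : ℕ) {x y : Euc d} (hx : x ∈ X) (hy : y ∈ X) :
    ‖G.r j • (x - y)‖ ≤ G.r j * G.D := by
  rw [norm_smul, Real.norm_of_nonneg (G.r_pos j).le]
  exact mul_le_mul_of_nonneg_left (G.norm_sub_le x hx y hy) (G.r_pos j).le

theorem mul_norm_gridVec_sub_le {ω ω' : ∀ j, G.system.I j} {j n : ℕ} (hjn : j < n)
    (h : ∀ i < j, ω i = ω' i) {p : Euc d} (hp : p ∈ X) :
    G.ratio j * (G.δ j * ‖gridVec (ω j) - gridVec (ω' j)‖ - G.r j * G.D) ≤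
      ‖G.system.seqMap ω 0 n p - G.system.seqMap ω' 0 n p‖ := by
  obtain ⟨x, hx, y, hy, he⟩ := G.exists_seqMap_sub hjn h hp
  rw [he, norm_smul, Real.norm_of_nonneg (G.ratio_pos j).le]
  refine mul_le_mul_of_nonneg_left ?_ (G.ratio_pos j).le
  have h1 := _root_.norm_sub_le (G.r j • (x - y) + G.δ j • (gridVec (ω j) - gridVec (ω' j)))
    (G.r j • (x - y))
  rw [add_sub_cancel_left, norm_smul, Real.norm_of_nonneg (G.δ_pos j).le] at h1
  linarith [G.norm_smul_sub_le j hx hy]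

/-- At the first disagreement `i < j` the grid positions differ by at least one mesh, and the images
use up at most half of it; what remains is at least `ratio (i + 1) * D`. -/
theorem ratio_mul_D_le {ω ω' : ∀ j, G.system.I j} {j n : ℕ} (hjn : j < n)
    (h : ∃ i < j, ω i ≠ ω' i) {p : Euc d} (hp : p ∈ X) :
    G.ratio j * G.D ≤ ‖G.system.seqMap ω 0 n p - G.system.seqMap ω' 0 n p‖ := by
  classical
  set i := Nat.find h
  obtain ⟨hij, hne⟩ := Nat.find_spec h
  have hlt : ∀ l < i, ω l = ω' l := fun l hl => by
    by_contra hl'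
    exact Nat.find_min h hl ⟨hl.trans hij, hl'⟩
  refine le_trans ?_ (G.mul_norm_gridVec_sub_le (hij.trans hjn) hlt hp)
  have hD : 0 ≤ G.D := G.R_pos.le.trans G.R_le_D
  have h1 : 1 < G.M i := G.one_lt_M (v := ω i) (w := ω' i) hne
  have h2 := G.ratio_le i h1
  have h3 := mul_le_mul_of_nonneg_left (one_le_norm_gridVec_sub (d := d) (v := ω i) (w := ω' i) hne)
    (G.δ_pos i).le
  calc G.ratio j * G.D ≤ G.ratio (i + 1) * G.D :=
        mul_le_mul_of_nonneg_right (G.ratio_antitone hij) hD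
    _ = G.ratio i * (G.r i * G.D) := by rw [ratio_succ, mul_assoc]
    _ ≤ _ := by
        refine mul_le_mul_of_nonneg_left ?_ (G.ratio_pos i).le
        linarith

/-- The diameter, up to constants, of the union of the images of a cylinder of length `n` under the
maps at stage `n`. -/
def clusterSize (n : ℕ) : ℝ := G.ratio n * G.δ n * G.M n

theorem clusterSize_pos (n : ℕ) : 0 < G.clusterSize n :=
  mul_pos (mul_pos (G.ratio_pos n) (G.δ_pos n)) (by exact_mod_cast G.M_pos n)

theorem clusterSize_le (hd : 0 < d) {n : ℕ} (hn : 1 < G.M n) :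
    G.clusterSize n ≤ G.ratio n * G.D := by
  rw [clusterSize, mul_assoc]
  refine mul_le_mul_of_nonneg_left ?_ (G.ratio_pos n).le
  have h1 := G.mesh_le n hn
  have h2 : (1 : ℝ) ≤ d := by exact_mod_cast hd
  have h3 : 0 < G.δ n * G.M n := mul_pos (G.δ_pos n) (by exact_mod_cast G.M_pos n)
  nlinarith [G.r_pos n, G.R_pos, G.R_le_D]

/-- Words with points in the ball agree before stage `j`, since otherwise the points would be at
least a cluster size apart. At stage `j` their grid coordinates differ by at most `2r / mesh + 1/2`,
the `1/2` absorbing the diameter of the images, so the letters fill at most an integer cube of side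
`2N + 1`. -/
theorem encard_initial_le (hd : 0 < d) {j n : ℕ} (hjn : j < n) (hM : 1 < G.M j) {r : ℝ}
    (hr : 2 * r < G.clusterSize j) (x : Euc d) :
    {τ : G.system.Word (j + 1) | ∃ ω : G.system.Word n, G.system.map ω G.z ∈ Metric.ball x r ∧
      G.system.initial (G.system.extend ω) (j + 1) = τ}.encard ≤
      ((2 * ⌊2 * r / (G.ratio j * G.δ j) + 1 / 2⌋₊ + 1) ^ d : ℕ) := by
  set N := ⌊2 * r / (G.ratio j * G.δ j) + 1 / 2⌋₊ with hN
  set T := {τ : G.system.Word (j + 1) | ∃ ω : G.system.Word n,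
    G.system.map ω G.z ∈ Metric.ball x r ∧
      G.system.initial (G.system.extend ω) (j + 1) = τ} with hT
  have hσ : 0 < G.ratio j * G.δ j := mul_pos (G.ratio_pos j) (G.δ_pos j)
  have hclose : ∀ ω ω' : G.system.Word n, G.system.map ω G.z ∈ Metric.ball x r →
      G.system.map ω' G.z ∈ Metric.ball x r →
      ‖G.system.seqMap (G.system.extend ω) 0 n G.z -
        G.system.seqMap (G.system.extend ω') 0 n G.z‖ < 2 * r := by
    intro ω ω' h h'
    rw [NCIFS.map_eq_seqMap] at h h'
    rw [← dist_eq_norm]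
    have := dist_triangle_right (G.system.seqMap (G.system.extend ω) 0 n G.z)
      (G.system.seqMap (G.system.extend ω') 0 n G.z) x
    rw [Metric.mem_ball] at h h'
    linarith
  have hagree : ∀ ω ω' : G.system.Word n, G.system.map ω G.z ∈ Metric.ball x r →
      G.system.map ω' G.z ∈ Metric.ball x r →
      ∀ i < j, G.system.extend ω i = G.system.extend ω' i := by
    intro ω ω' h h'
    by_contra! hne
    have h1 := G.ratio_mul_D_le hjn hne G.z_mem
    linarith [hclose ω ω' h h', G.clusterSize_le hd hM]
  have hcoord : ∀ ω ω' : G.system.Word n, G.system.map ω G.z ∈ Metric.ball x r →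
      G.system.map ω' G.z ∈ Metric.ball x r → ∀ i : Fin d,
      ((G.system.extend ω j i : ℕ) : ℤ) - (G.system.extend ω' j i : ℕ) ≤ N := by
    intro ω ω' h h' i
    have h1 := G.mul_norm_gridVec_sub_le hjn (hagree ω ω' h h') G.z_mem
    have h2 := (le_abs_self _).trans (abs_sub_le_norm_gridVec_sub
      (show Fin d → Fin (G.M j) from G.system.extend ω j) (G.system.extend ω' j) i)
    have h3 := hclose ω ω' h h'
    have h4 := mul_le_mul_of_nonneg_left (G.ratio_le j hM) (G.ratio_pos j).le
    have h5 := mul_le_mul_of_nonneg_left h2 hσ.le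
    have h6 : ((G.system.extend ω j i : ℕ) : ℝ) - (G.system.extend ω' j i : ℕ) ≤
        2 * r / (G.ratio j * G.δ j) + 1 / 2 := by
      rw [div_add' _ _ _ hσ.ne', le_div_iff₀ hσ]
      linarith
    have h7 : (((G.system.extend ω j i : ℕ) - (G.system.extend ω' j i : ℕ) : ℕ) : ℝ) ≤
        2 * r / (G.ratio j * G.δ j) + 1 / 2 := by
      rcases le_total (G.system.extend ω' j i : ℕ) (G.system.extend ω j i : ℕ) with hle | hle
      · rwa [Nat.cast_sub hle]
      · rw [Nat.sub_eq_zero_of_le hle, Nat.cast_zero]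
        by_contra! hneg
        have hr' : 0 < r := Metric.nonempty_ball.1 ⟨_, h⟩
        have : 0 < 2 * r / (G.ratio j * G.δ j) := by positivity
        linarith
    have h8 := Nat.le_floor h7
    omega
  rcases T.eq_empty_or_nonempty with hTe | ⟨τ₀, ω₀, hω₀, -⟩
  · rw [hTe, encard_empty]
    exact zero_le
  let v₀ : Fin d → ℕ := fun i => G.system.extend ω₀ j i
  let g : G.system.Word (j + 1) → Fin d → ℕ := fun τ i => G.system.extend τ j i
  have hg : InjOn g T := by
    rintro _ ⟨ω, hω, rfl⟩ _ ⟨ω', hω', rfl⟩ h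
    rw [NCIFS.initial_eq_iff]
    intro i hi
    rcases Nat.lt_succ_iff_lt_or_eq.1 hi with hi | rfl
    · exact hagree ω ω' hω hω' i hi
    · have e := fun ω : G.system.Word n =>
        G.system.extend_apply (G.system.initial (G.system.extend ω) (i + 1)) ⟨i, hi⟩
      refine funext fun l => Fin.ext ?_
      have := congrFun h l
      simp only [g] at this
      exact (congrArg Fin.val (congrFun (e ω) l)).symm.trans
        (this.trans (congrArg Fin.val (congrFun (e ω') l)))
  have hmaps : MapsTo g T
      (Fintype.piFinset fun i => Finset.Icc (v₀ i - N) (v₀ i + N) : Finset (Fin d → ℕ)) := by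
    rintro _ ⟨ω, hω, rfl⟩
    rw [Finset.mem_coe, Fintype.mem_piFinset]
    intro i
    have e : g (G.system.initial (G.system.extend ω) (j + 1)) i = (G.system.extend ω j i : ℕ) :=
      congrArg Fin.val (congrFun
        (G.system.extend_apply (G.system.initial (G.system.extend ω) (j + 1))
          ⟨j, j.lt_succ_self⟩) i)
    rw [e, Finset.mem_Icc]
    have h1 := hcoord ω ω₀ hω hω₀ i
    have h2 := hcoord ω₀ ω hω₀ hω i
    constructor
    · show (G.system.extend ω₀ j i : ℕ) - N ≤ _
      omega
    · show _ ≤ (G.system.extend ω₀ j i : ℕ) + N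
      omega
  refine (encard_le_encard_of_injOn hmaps hg).trans ?_
  rw [encard_coe_eq_coe_finsetCard, Fintype.card_piFinset, Nat.cast_le]
  calc ∏ i, (Finset.Icc (v₀ i - N) (v₀ i + N)).card ≤ ∏ _i : Fin d, (2 * N + 1) :=
        Finset.prod_le_prod' fun i _ => by rw [Nat.card_Icc]; omega
    _ = (2 * N + 1) ^ d := by simp

/-- The cylinder estimate at exponent `0`, where the distortion constant disappears. -/
theorem tsum_cylinder_le [Nontrivial (Euc d)] {k n : ℕ} (hkn : k ≤ n) (τ : G.system.Word k) :
    ∑' _ : G.system.cylinder τ n, (G.count n : ℝ≥0∞)⁻¹ ≤ (G.count k : ℝ≥0∞)⁻¹ := by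
  have h := G.system.tsum_cylinder_mul_Z_le 0 hkn τ
  have hpos : ∀ n, (G.count n : ℝ≥0∞) ≠ 0 := fun n => by exact_mod_cast (G.count_pos n).ne'
  simp only [G.Z_eq, NNReal.coe_zero, ENNReal.rpow_zero, Real.rpow_zero, mul_one,
    ENNReal.ofReal_natCast, one_mul] at h
  calc ∑' _ : G.system.cylinder τ n, (G.count n : ℝ≥0∞)⁻¹
      = (∑' _ : G.system.cylinder τ n, 1) * (G.count n : ℝ≥0∞)⁻¹ := by
        rw [← ENNReal.tsum_mul_right, one_mul]
    _ ≤ (G.count n / G.count k) * (G.count n : ℝ≥0∞)⁻¹ := by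
        gcongr
        rwa [ENNReal.le_div_iff_mul_le (Or.inl (hpos k)) (Or.inl (by simp))]
    _ = (G.count k : ℝ≥0∞)⁻¹ := by
        rw [div_eq_mul_inv, mul_right_comm, ENNReal.mul_inv_cancel (hpos n) (by simp), one_mul]

theorem count_eq_of_M_eq_one {m n : ℕ} (hmn : m ≤ n) (h : ∀ j, m ≤ j → j < n → G.M j = 1) :
    G.count n = G.count m := by
  induction n, hmn using Nat.le_induction with
  | base => rfl
  | succ n hn ih =>
    rw [count_succ, ih fun j h1 h2 => h j h1 (h2.trans n.lt_succ_self), h n hn n.lt_succ_self,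
      one_pow, mul_one]

/-- Below the mesh `σ` at most `6^d` words matter, and their mass is governed by the next cluster
size because nothing branches in between. Above the mesh the mass inside the cluster of size `c`
scales like `(r / c)^d ≤ (r / c)^t`, as `r ≤ c` and `t ≤ d`. -/
theorem pow_div_count_le {t : ℝ} (ht0 : 0 ≤ t) (ht : t ≤ d) {a : ℕ → ℕ}
    (ha : StrictMono a) (hM : ∀ k j, a k < j → j < a (k + 1) → G.M j = 1) {C : ℝ}
    (hC : 0 ≤ C) (hB : ∀ k, 1 ≤ C * (G.count (a k) * G.clusterSize (a k) ^ t)) {k : ℕ} {r : ℝ}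
    (hr : 0 < r) (hr1 : 2 * r < G.clusterSize (a k)) (hr2 : G.clusterSize (a (k + 1)) ≤ 2 * r) :
    ((2 * ⌊2 * r / (G.ratio (a k) * G.δ (a k)) + 1 / 2⌋₊ + 1) ^ d : ℕ) / (G.count (a k + 1) : ℝ) ≤
      6 ^ d * C * 2 ^ t * r ^ t := by
  set σ := G.ratio (a k) * G.δ (a k) with hσdef
  have hσ : 0 < σ := mul_pos (G.ratio_pos _) (G.δ_pos _)
  have hfl : (2 * ⌊2 * r / σ + 1 / 2⌋₊ + 1 : ℝ) ≤ 4 * r / σ + 2 := by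
    have h : (⌊2 * r / σ + 1 / 2⌋₊ : ℝ) ≤ 2 * r / σ + 1 / 2 := Nat.floor_le (by positivity)
    have e : 4 * r / σ = 2 * (2 * r / σ) := by ring
    linarith
  have hpos : ∀ n, (0 : ℝ) < G.count n := fun n => by exact_mod_cast G.count_pos n
  have hcs := fun n => G.clusterSize_pos n
  push_cast
  rw [div_le_iff₀ (hpos _)]
  rcases le_total r σ with hrσ | hrσ
  · have h1 : (2 * ⌊2 * r / σ + 1 / 2⌋₊ + 1 : ℝ) ≤ 6 := by
      have : r / σ ≤ 1 := (div_le_one hσ).2 hrσ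
      have e : 4 * r / σ = 4 * (r / σ) := by ring
      linarith
    have h2 := hB (k + 1)
    have h3 : G.count (a (k + 1)) = G.count (a k + 1) :=
      G.count_eq_of_M_eq_one (ha k.lt_succ_self) fun j h1 h2 => hM k j h1 h2
    have h4 : G.clusterSize (a (k + 1)) ^ t ≤ 2 ^ t * r ^ t := by
      rw [← Real.mul_rpow two_pos.le hr.le]
      exact Real.rpow_le_rpow (hcs _).le hr2 ht0
    rw [h3] at h2
    calc (2 * ⌊2 * r / σ + 1 / 2⌋₊ + 1 : ℝ) ^ d ≤ 6 ^ d * 1 := by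
          rw [mul_one]
          gcongr
      _ ≤ 6 ^ d * (C * (G.count (a k + 1) * G.clusterSize (a (k + 1)) ^ t)) := by gcongr
      _ ≤ 6 ^ d * (C * (G.count (a k + 1) * (2 ^ t * r ^ t))) := by gcongr
      _ = _ := by ring
  · have h1 : (2 * ⌊2 * r / σ + 1 / 2⌋₊ + 1 : ℝ) ≤ 6 * (r / σ) := by
      have : 1 ≤ r / σ := (one_le_div hσ).2 hrσ
      have e : 4 * r / σ = 4 * (r / σ) := by ring
      linarith
    set c := G.clusterSize (a k) with hc
    have hc0 : 0 < c := hcs _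
    have hcσ : c = σ * G.M (a k) := rfl
    have hM0 : (0 : ℝ) < G.M (a k) := by exact_mod_cast G.M_pos _
    have h2 : (r / c) ^ d * c ^ t ≤ r ^ t := by
      have h3 : r / c ≤ 1 := by rw [div_le_one hc0]; linarith
      calc (r / c) ^ d * c ^ t = (r / c) ^ (d : ℝ) * c ^ t := by rw [Real.rpow_natCast]
        _ ≤ (r / c) ^ t * c ^ t := by
            gcongr ?_ * _
            exact Real.rpow_le_rpow_of_exponent_ge (by positivity) h3 ht
        _ = r ^ t := by
            rw [← Real.mul_rpow (by positivity) hc0.le, div_mul_cancel₀ _ hc0.ne']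
    have h2t : (1 : ℝ) ≤ 2 ^ t := Real.one_le_rpow one_le_two ht0
    calc (2 * ⌊2 * r / σ + 1 / 2⌋₊ + 1 : ℝ) ^ d ≤ (6 * (r / σ)) ^ d * 1 := by
          rw [mul_one]
          gcongr
      _ ≤ (6 * (r / σ)) ^ d * (C * (G.count (a k) * c ^ t)) := by
          gcongr
          exact hB k
      _ = 6 ^ d * C * (G.count (a k) * G.M (a k) ^ d) * ((r / c) ^ d * c ^ t) := by
          rw [show r / σ = r / c * G.M (a k) by rw [hcσ]; field_simp, mul_pow, mul_pow]
          ring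
      _ ≤ 6 ^ d * C * (G.count (a k) * G.M (a k) ^ d) * (2 ^ t * r ^ t) := by
          refine mul_le_mul_of_nonneg_left (h2.trans ?_) (by positivity)
          exact le_mul_of_one_le_left (Real.rpow_nonneg hr.le t) h2t
      _ = _ := by
          rw [count_succ]
          push_cast
          ring

theorem le_dimH_limitSet [Nontrivial (Euc d)] (hd : 0 < d) (hX : IsCompact X) {t : ℝ≥0}
    (ht : (t : ℝ) ≤ d) {a : ℕ → ℕ} (ha : StrictMono a) (hM1 : ∀ k, 1 < G.M (a k))
    (hM : ∀ k j, a k < j → j < a (k + 1) → G.M j = 1)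
    (hlim : Tendsto (fun k => G.clusterSize (a k)) atTop (𝓝 0)) {C : ℝ} (hC : 0 ≤ C)
    (hB : ∀ k, 1 ≤ C * (G.count (a k) * G.clusterSize (a k) ^ (t : ℝ))) :
    (t : ℝ≥0∞) ≤ dimH G.system.limitSet := by
  have hpos : ∀ n, (G.count n : ℝ≥0∞) ≠ 0 := fun n => by exact_mod_cast (G.count_pos n).ne'
  refine G.system.le_dimH_limitSet_of_weights hX G.system_isFinite G.z_mem
    (fun n _ => (G.count n : ℝ≥0∞)⁻¹) (Eventually.of_forall fun n => ?_)
    (C := (6 ^ d * C * 2 ^ (t : ℝ)).toNNReal) (half_pos (G.clusterSize_pos (a 0)))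
    fun r hr hr0 => ?_
  · have := G.system.finite_word G.system_isFinite n
    rw [ENNReal.tsum_const, ENat.card_eq_coe_natCard, card_word]
    exact (ENNReal.mul_inv_cancel (hpos n) (by simp)).ge
  -- The cluster sizes start above `2r` and tend to `0`, so two consecutive ones straddle `2r`.
  obtain ⟨k, hk1, hk2⟩ : ∃ k, 2 * r < G.clusterSize (a k) ∧ G.clusterSize (a (k + 1)) ≤ 2 * r := by
    by_contra! h
    have hall : ∀ k, 2 * r < G.clusterSize (a k) := fun k => by
      induction k with
      | zero => linarith
      | succ k ih => exact h k ih
    have := ge_of_tendsto' hlim fun k => (hall k).le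
    linarith
  filter_upwards [eventually_gt_atTop (a k)] with n hn x
  set T := {τ : G.system.Word (a k + 1) | ∃ ω : G.system.Word n,
    G.system.map ω G.z ∈ Metric.ball x r ∧
      G.system.initial (G.system.extend ω) (a k + 1) = τ} with hT
  have hsub : {ω : G.system.Word n | G.system.map ω G.z ∈ Metric.ball x r} ⊆
      ⋃ τ : T, G.system.cylinder τ.1 n :=
    fun ω hω => mem_iUnion.2 ⟨⟨_, ω, hω, rfl⟩, rfl⟩
  set w : G.system.Word n → ℝ≥0∞ := fun _ => (G.count n : ℝ≥0∞)⁻¹ with hw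
  have hcount : (0 : ℝ) < G.count (a k + 1) := by exact_mod_cast G.count_pos _
  calc ∑' ω : {ω : G.system.Word n | G.system.map ω G.z ∈ Metric.ball x r}, w ω
      ≤ ∑' ω : (⋃ τ : T, G.system.cylinder τ.1 n : Set (G.system.Word n)), w ω :=
        ENNReal.tsum_mono_subtype w hsub
    _ ≤ ∑' τ : T, ∑' ω : G.system.cylinder τ.1 n, w ω := ENNReal.tsum_iUnion_le_tsum w _
    _ ≤ ∑' _ : T, (G.count (a k + 1) : ℝ≥0∞)⁻¹ :=
        ENNReal.tsum_le_tsum fun τ => G.tsum_cylinder_le hn τ.1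
    _ = T.encard * (G.count (a k + 1) : ℝ≥0∞)⁻¹ := ENNReal.tsum_set_const _ _
    _ ≤ (((2 * ⌊2 * r / (G.ratio (a k) * G.δ (a k)) + 1 / 2⌋₊ + 1) ^ d : ℕ) : ℝ≥0∞) *
          (G.count (a k + 1) : ℝ≥0∞)⁻¹ := by
        gcongr
        have := ENat.toENNReal_le.2 (G.encard_initial_le hd hn (hM1 k) hk1 x)
        rwa [ENat.toENNReal_coe] at this
    _ = ENNReal.ofReal (((2 * ⌊2 * r / (G.ratio (a k) * G.δ (a k)) + 1 / 2⌋₊ + 1) ^ d : ℕ) /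
          (G.count (a k + 1) : ℝ)) := by
        rw [ENNReal.ofReal_div_of_pos hcount, ENNReal.ofReal_natCast, ENNReal.ofReal_natCast]
        exact (div_eq_mul_inv _ _).symm
    _ ≤ ENNReal.ofReal (6 ^ d * C * 2 ^ (t : ℝ) * r ^ (t : ℝ)) :=
        ENNReal.ofReal_le_ofReal (G.pow_div_count_le t.2 ht ha hM hC hB hr hk1 hk2)
    _ = _ := by
        rw [ENNReal.ofReal_mul (by positivity), ENNReal.ofReal_rpow_of_pos hr]
        rfl

/-- The efficient cover uses, for each word of length `a k`, the cluster of its children instead of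
its full image of `X`. -/
theorem dimH_limitSet_le {t : ℝ≥0} {a : ℕ → ℕ} (hM1 : ∀ k, 1 < G.M (a k))
    (hlim : Tendsto (fun k => G.clusterSize (a k)) atTop (𝓝 0)) {C : ℝ}
    (hB : ∀ k, G.count (a k) * G.clusterSize (a k) ^ (t : ℝ) ≤ C) :
    dimH G.system.limitSet ≤ t := by
  have ht0 : (0 : ℝ) ≤ t := t.2
  let T : ∀ k, G.system.Word (a k) → Set (Euc d) := fun k σ =>
    ⋃ v : G.system.I (a k), G.system.map σ '' (G.system.φ (a k) v '' X)
  have hdiam : ∀ k σ, Metric.ediam (T k σ) ≤ ENNReal.ofReal ((d + 1) * G.clusterSize (a k)) := by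
    intro k σ
    refine Metric.ediam_le fun x' hx' y' hy' => ?_
    obtain ⟨v, _, ⟨x, hx, rfl⟩, rfl⟩ := mem_iUnion.1 hx'
    obtain ⟨w, _, ⟨y, hy, rfl⟩, rfl⟩ := mem_iUnion.1 hy'
    rw [edist_dist, dist_eq_norm, NCIFS.map_eq_seqMap, seqMap_sub,
      show G.system.φ (a k) v x - G.system.φ (a k) w y = _ from G.gridMap_sub (a k) v w x y,
      norm_smul, Real.norm_of_nonneg (G.ratio_pos _).le]
    refine ENNReal.ofReal_le_ofReal ?_
    have h1 := norm_add_le (G.r (a k) • (x - y)) (G.δ (a k) • (gridVec v - gridVec w))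
    have h2 := G.norm_smul_sub_le (a k) hx hy
    have h3 : ‖G.δ (a k) • (gridVec v - gridVec w)‖ ≤ G.δ (a k) * (d * G.M (a k)) := by
      rw [norm_smul, Real.norm_of_nonneg (G.δ_pos _).le]
      exact mul_le_mul_of_nonneg_left (norm_gridVec_sub_le v w) (G.δ_pos _).le
    have h4 := G.ratio_le _ (hM1 k)
    have h5 : (1 : ℝ) ≤ G.M (a k) := by exact_mod_cast G.M_pos _
    have h6 := G.δ_pos (a k)
    rw [clusterSize, mul_assoc (G.ratio (a k)), mul_left_comm]
    refine mul_le_mul_of_nonneg_left ?_ (G.ratio_pos _).le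
    nlinarith
  have hlim' : Tendsto (fun k => ENNReal.ofReal ((d + 1) * G.clusterSize (a k))) atTop (𝓝 0) := by
    have := ENNReal.tendsto_ofReal (hlim.const_mul ((d : ℝ) + 1))
    simpa using this
  have hcount : ∀ k, Countable (G.system.Word (a k)) := fun k => by
    have := G.system.finite_word G.system_isFinite (a k)
    infer_instance
  have hμ := Measure.hausdorffMeasure_le_liminf_tsum (t : ℝ) G.system.limitSet _ hlim' T
    (Eventually.of_forall hdiam) (Eventually.of_forall fun k x hx => by
      obtain ⟨ω, y, hy, rfl⟩ := mem_iUnion.1 (G.system.limitSet_subset (a k + 1) hx)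
      rw [NCIFS.map_eq_seqMap, NCIFS.seqMap_succ]
      exact mem_iUnion.2 ⟨G.system.initial (G.system.extend ω) (a k),
        mem_iUnion.2 ⟨_, mem_image_of_mem _ (mem_image_of_mem _ hy)⟩⟩)
  refine dimH_le_of_hausdorffMeasure_ne_top ((hμ.trans_lt (lt_of_le_of_lt
    (b := ENNReal.ofReal ((d + 1) ^ (t : ℝ) * C)) ?_ ENNReal.ofReal_lt_top)).ne)
  refine liminf_le_of_frequently_le (Frequently.of_forall fun k => ?_)
  have hc := G.clusterSize_pos (a k)
  have := G.system.finite_word G.system_isFinite (a k)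
  calc ∑' σ, Metric.ediam (T k σ) ^ (t : ℝ)
      ≤ ∑' _ : G.system.Word (a k), ENNReal.ofReal (((d + 1) * G.clusterSize (a k)) ^ (t : ℝ)) := by
        refine ENNReal.tsum_le_tsum fun σ => ?_
        rw [← ENNReal.ofReal_rpow_of_pos (by positivity)]
        exact ENNReal.rpow_le_rpow (hdiam k σ) ht0
    _ = ENNReal.ofReal ((d + 1) ^ (t : ℝ) * (G.count (a k) * G.clusterSize (a k) ^ (t : ℝ))) := by
        rw [ENNReal.tsum_const, ENat.card_eq_coe_natCard, card_word, mul_left_comm,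
          ← Real.mul_rpow (by positivity) hc.le, ENNReal.ofReal_mul (Nat.cast_nonneg _),
          ENNReal.ofReal_natCast, ENat.toENNReal_coe]
    _ ≤ _ := by
        refine ENNReal.ofReal_le_ofReal (mul_le_mul_of_nonneg_left (hB k) (by positivity))

end GridData

/-! ### Choice of the parameters: sparse branching -/

/-- The numerical parameters of a system of homotheties which has `2 ^ (d * n / q)` maps at the
stages `n = q * m * l ^ k` and a single map at all other stages. -/
structure SparseData (d : ℕ) (t₁ t₂ : ℝ) where
  q : ℕ
  m : ℕ
  l : ℕ
  d_pos : 0 < d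
  q_pos : 0 < q
  m_pos : 0 < m
  two_le_l : 2 ≤ l
  t₁_pos : 0 < t₁
  t₁_lt : t₁ < t₂
  t₂_lt : t₂ < d
  -- Makes `l` so large that the crowding exponent `(1/t₁ - 1/t₂) S` takes at most a quarter of the
  -- slack `rate * n * (1/t₂ - 1/d)` at a branching stage `n`.
  gap_le : 4 * (1 / t₁ - 1 / t₂) ≤ ((l : ℝ) - 1) * (1 / t₂ - 1 / d)

namespace SparseData

variable {d : ℕ} {t₁ t₂ : ℝ} (P : SparseData d t₁ t₂)

/-- The branching stages. -/
def stage (k : ℕ) : ℕ := P.q * P.m * P.l ^ k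

/-- The logarithmic growth rate of the alphabets along the branching stages. -/
def rate : ℝ := d * Real.log 2 / P.q

/-- The logarithm of the contraction ratio at the non-branching stages. -/
def rho : ℝ := P.rate * (1 / t₂ - 1 / d) / (4 * (P.l - 1))

open Classical in
/-- The number of maps at each stage is a `d`-th power; this is its root. -/
def M (n : ℕ) : ℕ := if n ∈ range P.stage then 2 ^ (n / P.q) else 1

open Classical in
/-- The logarithms of the contraction ratios. -/
def logRatio (n : ℕ) : ℝ :=
  -- A quarter of the gap is withheld here; `rho` is such that its contributions up to the next
  -- branching stage restore it.
  if n ∈ range P.stage then P.rate * (1 / t₂ - (1 / t₂ - 1 / d) / 4) * n + P.rho else P.rho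

/-- The logarithm of the number of words. -/
def S (n : ℕ) : ℝ := ∑ j ∈ Finset.range n, d * Real.log (P.M j)

/-- The logarithm of the contraction ratio of a word. -/
def W (n : ℕ) : ℝ := ∑ j ∈ Finset.range n, P.logRatio j

theorem t₂_pos (P : SparseData d t₁ t₂) : 0 < t₂ := P.t₁_pos.trans P.t₁_lt

theorem gap_pos (P : SparseData d t₁ t₂) : 0 < 1 / t₂ - 1 / (d : ℝ) :=
  sub_pos.2 (one_div_lt_one_div_of_lt P.t₂_pos P.t₂_lt)

theorem gap_pos' (P : SparseData d t₁ t₂) : 0 < 1 / t₁ - 1 / t₂ :=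
  sub_pos.2 (one_div_lt_one_div_of_lt P.t₁_pos P.t₁_lt)

theorem one_lt_l : (1 : ℝ) < P.l := by exact_mod_cast P.two_le_l

theorem rate_pos : 0 < P.rate := by
  have := P.d_pos
  have := P.q_pos
  have := Real.log_pos one_lt_two
  unfold rate
  positivity

theorem rho_pos : 0 < P.rho :=
  div_pos (mul_pos P.rate_pos P.gap_pos) (mul_pos four_pos (sub_pos.2 P.one_lt_l))

theorem rho_mul : P.rho * (P.l - 1) = P.rate * (1 / t₂ - 1 / d) / 4 := by
  have := sub_pos.2 P.one_lt_l
  rw [rho]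
  field_simp

theorem stage_succ (k : ℕ) : P.stage (k + 1) = P.l * P.stage k := by
  unfold stage
  ring

theorem stage_pos (k : ℕ) : 0 < P.stage k :=
  Nat.mul_pos (Nat.mul_pos P.q_pos P.m_pos) (pow_pos (by have := P.two_le_l; omega) k)

theorem stage_strictMono : StrictMono P.stage := strictMono_nat_of_lt_succ fun k => by
  rw [stage_succ]
  have h1 := P.stage_pos k
  have h2 := P.two_le_l
  nlinarith

theorem M_stage (k : ℕ) : P.M (P.stage k) = 2 ^ (P.m * P.l ^ k) := by
  rw [M, if_pos (mem_range_self k), stage, mul_assoc, Nat.mul_div_cancel_left _ P.q_pos]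

theorem M_of_notMem {n : ℕ} (h : n ∉ range P.stage) : P.M n = 1 := if_neg h

theorem M_pos (n : ℕ) : 0 < P.M n := by
  unfold M
  split_ifs <;> positivity

theorem one_lt_M_stage (k : ℕ) : 1 < P.M (P.stage k) := by
  rw [M_stage]
  exact Nat.one_lt_two_pow (Nat.mul_pos P.m_pos (pow_pos (by have := P.two_le_l; omega) k)).ne'

theorem log_M_stage (k : ℕ) : d * Real.log (P.M (P.stage k)) = P.rate * P.stage k := by
  have hq : (P.q : ℝ) ≠ 0 := by exact_mod_cast P.q_pos.ne'
  rw [M_stage, rate, stage]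
  push_cast
  rw [Real.log_pow]
  field_simp
  push_cast
  ring

theorem rho_le_logRatio (n : ℕ) : P.rho ≤ P.logRatio n := by
  unfold logRatio
  split_ifs
  · have h1 := P.rate_pos
    have h2 : 0 < 1 / t₂ := one_div_pos.2 P.t₂_pos
    have h3 : 0 ≤ 1 / (d : ℝ) := by positivity
    have h4 : 0 ≤ P.rate * (1 / t₂ - (1 / t₂ - 1 / d) / 4) * n :=
      mul_nonneg (mul_nonneg h1.le (by linarith)) (Nat.cast_nonneg n)
    linarith
  · exact le_rfl

theorem notMem_range_stage {k n : ℕ} (h1 : P.stage k < n) (h2 : n < P.stage (k + 1)) :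
    n ∉ range P.stage := by
  rintro ⟨i, rfl⟩
  have h3 := P.stage_strictMono.lt_iff_lt.1 h1
  have h4 := P.stage_strictMono.lt_iff_lt.1 h2
  omega

theorem S_W_of_lt_of_le {k n : ℕ} (h1 : P.stage k < n) (h2 : n ≤ P.stage (k + 1)) :
    P.S n = P.S (P.stage k) + P.rate * P.stage k ∧
    P.W n = P.W (P.stage k) + P.rate * (1 / t₂ - (1 / t₂ - 1 / d) / 4) * P.stage k +
      P.rho * (n - P.stage k) := by
  induction n, h1 using Nat.le_induction with
  | base =>
    rw [S, Finset.sum_range_succ, ← S, W, Finset.sum_range_succ, ← W, log_M_stage, logRatio,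
      if_pos (mem_range_self k)]
    refine ⟨rfl, ?_⟩
    push_cast
    ring
  | succ n hn ih =>
    obtain ⟨i1, i2⟩ := ih (by omega)
    have hnot := P.notMem_range_stage hn (by omega : n < P.stage (k + 1))
    rw [S, Finset.sum_range_succ, ← S, W, Finset.sum_range_succ, ← W, i1, i2, logRatio, if_neg hnot,
      P.M_of_notMem hnot]
    refine ⟨by simp, ?_⟩
    push_cast
    ring

theorem S_W_of_le {n : ℕ} (h : n ≤ P.stage 0) : P.S n = 0 ∧ P.W n = P.rho * n := by
  have hnot : ∀ j < n, j ∉ range P.stage := by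
    rintro _ hj ⟨i, rfl⟩
    have := P.stage_strictMono.monotone (Nat.zero_le i)
    omega
  constructor
  · refine Finset.sum_eq_zero fun j hj => ?_
    rw [P.M_of_notMem (hnot j (Finset.mem_range.1 hj))]
    simp
  · have h1 : ∀ j ∈ Finset.range n, P.logRatio j = P.rho :=
      fun j hj => if_neg (hnot j (Finset.mem_range.1 hj))
    rw [W, Finset.sum_congr rfl h1]
    simp [mul_comm]

theorem S_stage_succ (k : ℕ) :
    P.S (P.stage (k + 1)) = P.S (P.stage k) + P.rate * P.stage k :=
  (P.S_W_of_lt_of_le (P.stage_strictMono k.lt_succ_self) le_rfl).1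

/-- From `n = stage k` to the next branching stage `S` gains `rate * n`, and `W` gains `rate * n /
t₂` once the withheld quarter is restored by `rho * (l - 1) * n`. -/
theorem W_stage (k : ℕ) : t₂ * (P.W (P.stage k) - P.rho * P.stage 0) = P.S (P.stage k) := by
  induction k with
  | zero =>
    obtain ⟨h1, h2⟩ := P.S_W_of_le le_rfl
    rw [h1, h2, sub_self, mul_zero]
  | succ k ih =>
    have h := (P.S_W_of_lt_of_le (P.stage_strictMono k.lt_succ_self) le_rfl).2
    have h0 := P.rho_mul
    have ht : t₂ * (1 / t₂) = 1 := mul_one_div_cancel P.t₂_pos.ne'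
    rw [S_stage_succ, ← ih, h, stage_succ]
    push_cast
    linear_combination (t₂ * P.stage k) * h0 + (P.rate * P.stage k) * ht

/-- The increments of `S` form a geometric series of ratio `l`, so past branchings are small
compared with the current one. -/
theorem S_stage_le (k : ℕ) : (P.l - 1) * P.S (P.stage k) ≤ P.rate * P.stage k := by
  induction k with
  | zero =>
    rw [(P.S_W_of_le le_rfl).1, mul_zero]
    exact mul_nonneg P.rate_pos.le (Nat.cast_nonneg _)
  | succ k ih =>
    rw [S_stage_succ, stage_succ]
    push_cast
    linarith

theorem W_mono : Monotone P.W := monotone_nat_of_le_succ fun n => by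
  rw [W, W, Finset.sum_range_succ]
  linarith [P.rho_le_logRatio n, P.rho_pos]

theorem le_W (n : ℕ) : P.rho * n ≤ P.W n := by
  have := Finset.card_nsmul_le_sum (Finset.range n) P.logRatio P.rho
    fun j _ => P.rho_le_logRatio j
  rw [Finset.card_range, nsmul_eq_mul, mul_comm] at this
  exact this

theorem S_nonneg (n : ℕ) : 0 ≤ P.S n :=
  Finset.sum_nonneg fun _ _ => mul_nonneg (Nat.cast_nonneg d) (Real.log_natCast_nonneg _)

/-- After a branching `S` already has its value at the next branching stage, where equality holds,
while `W` is still growing towards its value there. -/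
theorem le_S (n : ℕ) : t₂ * (P.W n - P.rho * P.stage 0) ≤ P.S n := by
  rcases le_or_gt n (P.stage 0) with h | h
  · obtain ⟨h1, h2⟩ := P.S_W_of_le h
    rw [h1, h2, ← mul_sub]
    refine mul_nonpos_of_nonneg_of_nonpos P.t₂_pos.le
      (mul_nonpos_of_nonneg_of_nonpos P.rho_pos.le (sub_nonpos.2 (by exact_mod_cast h)))
  · have hex : ∃ k, n ≤ P.stage k := ⟨n, P.stage_strictMono.le_apply⟩
    classical
    obtain ⟨k, hk⟩ : ∃ k, Nat.find hex = k + 1 := Nat.exists_eq_succ_of_ne_zero fun h0 => by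
      have := Nat.find_spec hex
      rw [h0] at this
      omega
    have h1 : P.stage k < n := not_le.1 (Nat.find_min hex (by omega))
    have h2 : n ≤ P.stage (k + 1) := hk ▸ Nat.find_spec hex
    rw [(P.S_W_of_lt_of_le h1 h2).1, ← S_stage_succ, ← W_stage]
    have := P.W_mono h2
    have := P.t₂_pos
    gcongr

/-- At a branching stage `n` the contraction exceeds the cost `rate * n / d` of the grid by three
quarters of `rate * n * (1/t₂ - 1/d)`. One quarter pays for the crowding, and half, through the size
of `m`, for the constant `log (2D / κ)`. -/
theorem exp_neg_logRatio_le {κ D : ℝ} (hκ : 0 < κ) (hD : 0 < D)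
    (hm : Real.log (2 * D / κ) ≤ P.m * (d * Real.log 2) * (1 / t₂ - 1 / d) / 2) (k : ℕ) :
    Real.exp (-P.logRatio (P.stage k)) * D ≤
      κ * Real.exp (-(1 / t₁ - 1 / t₂) * P.S (P.stage k)) / P.M (P.stage k) / 2 := by
  have hd : (0 : ℝ) < d := by exact_mod_cast P.d_pos
  have hM : (0 : ℝ) < P.M (P.stage k) := by exact_mod_cast P.M_pos _
  have hMexp : (P.M (P.stage k) : ℝ) = Real.exp (P.rate * P.stage k / d) := by
    rw [← P.log_M_stage, mul_div_cancel_left₀ _ hd.ne', Real.exp_log hM]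
  have hDexp : D = κ / 2 * Real.exp (Real.log (2 * D / κ)) := by
    rw [Real.exp_log (by positivity)]
    field_simp
  have hstage : P.m * (d * Real.log 2) ≤ P.rate * P.stage k := by
    have h1 : P.m * (d * Real.log 2) = P.rate * P.stage 0 := by
      have hq : (P.q : ℝ) ≠ 0 := by exact_mod_cast P.q_pos.ne'
      rw [rate, stage]
      push_cast
      field_simp
    rw [h1]
    have := P.stage_strictMono.monotone (Nat.zero_le k)
    have := P.rate_pos
    gcongr
  have hS : (1 / t₁ - 1 / t₂) * P.S (P.stage k) ≤
      P.rate * P.stage k * (1 / t₂ - 1 / d) / 4 := by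
    have h1 := P.S_stage_le k
    have h2 := P.gap_le
    have h3 := P.gap_pos
    have h4 := mul_le_mul_of_nonneg_right h2 (P.S_nonneg (P.stage k))
    have h5 := mul_le_mul_of_nonneg_right h1 h3.le
    linarith
  have hkey : -P.logRatio (P.stage k) + Real.log (2 * D / κ) ≤
      -(1 / t₁ - 1 / t₂) * P.S (P.stage k) - P.rate * P.stage k / d := by
    rw [logRatio, if_pos (mem_range_self k)]
    have h1 := mul_le_mul_of_nonneg_right hstage P.gap_pos.le
    have h2 := P.rho_pos
    have e : P.rate * P.stage k / d = P.rate * P.stage k * (1 / d) := by ring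
    rw [e]
    linarith
  calc Real.exp (-P.logRatio (P.stage k)) * D
      = κ / 2 * Real.exp (-P.logRatio (P.stage k) + Real.log (2 * D / κ)) := by
        rw [Real.exp_add]
        conv_lhs => rw [hDexp]
        ring
    _ ≤ κ / 2 * Real.exp (-(1 / t₁ - 1 / t₂) * P.S (P.stage k) - P.rate * P.stage k / d) := by
        gcongr
    _ = _ := by
        rw [Real.exp_sub, hMexp]
        ring

/-- The system of homotheties with parameters `P`. -/
def gridData {X : Set (Euc d)} (hX : Convex ℝ X) {z : Euc d} {R D : ℝ} (hR : 0 < R) (hRD : R ≤ D)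
    (hz : Metric.closedBall z R ⊆ X) (hD : ∀ x ∈ X, ∀ y ∈ X, ‖x - y‖ ≤ D)
    (hm : Real.log (2 * D / (R / (2 * d))) ≤
      P.m * (d * Real.log 2) * (1 / t₂ - 1 / d) / 2) : GridData X :=
  have hd : (1 : ℝ) ≤ d := by exact_mod_cast P.d_pos
  have hκ : 0 < R / (2 * d) := by positivity
  have hM : ∀ n, (1 : ℝ) ≤ P.M n := fun n => by exact_mod_cast P.M_pos n
  have hS : ∀ n, Real.exp (-(1 / t₁ - 1 / t₂) * P.S n) ≤ 1 := fun n => by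
    rw [Real.exp_le_one_iff]
    have := mul_nonneg P.gap_pos'.le (P.S_nonneg n)
    linarith
  have hratio : ∀ n, 1 < P.M n → Real.exp (-P.logRatio n) * D ≤
      R / (2 * d) * Real.exp (-(1 / t₁ - 1 / t₂) * P.S n) / P.M n / 2 := fun n hn => by
    have hmem : n ∈ range P.stage := by
      by_contra h
      rw [P.M_of_notMem h] at hn
      omega
    obtain ⟨k, rfl⟩ := hmem
    exact P.exp_neg_logRatio_le hκ (hR.trans_le hRD) hm k
  { z := z
    R := R
    D := D
    M := P.M
    r := fun n => Real.exp (-P.logRatio n)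
    -- The factor `exp (-(1/t₁ - 1/t₂) S)` is the crowding that turns `exp (-S / t₂)` into `exp (-S
    -- / t₁)`; `R / (2d)` keeps the grid inside half the ball, enough since branching ratios are at
    -- most `1/2`.
    δ := fun n => R / (2 * d) * Real.exp (-(1 / t₁ - 1 / t₂) * P.S n) / P.M n
    η := Real.exp (-P.rho)
    convex := hX
    R_pos := hR
    R_le_D := hRD
    ball_subset := hz
    norm_sub_le := hD
    M_pos := P.M_pos
    r_pos := fun n => Real.exp_pos _
    r_le := fun n => Real.exp_le_exp.2 (neg_le_neg (P.rho_le_logRatio n))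
    η_lt_one := by
      rw [Real.exp_lt_one_iff]
      linarith [P.rho_pos]
    δ_pos := fun n => div_pos (mul_pos hκ (Real.exp_pos _)) (one_pos.trans_le (hM n))
    mesh_le := fun n hn => by
      have h1 : Real.exp (-P.logRatio n) ≤ 1 / 2 := by
        have h2 := hratio n hn
        have h3 : R / (2 * d) * Real.exp (-(1 / t₁ - 1 / t₂) * P.S n) / P.M n ≤ R / 2 := by
          rw [div_le_iff₀ (one_pos.trans_le (hM n))]
          have h4 : R / (2 * d) ≤ R / 2 := by
            gcongr
            linarith
          calc R / (2 * d) * Real.exp (-(1 / t₁ - 1 / t₂) * P.S n) ≤ R / 2 * 1 := by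
                gcongr
                exact hS n
            _ ≤ R / 2 * P.M n := by
                gcongr
                exact hM n
        have hD0 : 0 < D := hR.trans_le hRD
        refine le_of_mul_le_mul_right ?_ hD0
        linarith
      rw [div_mul_cancel₀ _ (one_pos.trans_le (hM n)).ne']
      calc d * (R / (2 * d) * Real.exp (-(1 / t₁ - 1 / t₂) * P.S n)) ≤ d * (R / (2 * d) * 1) := by
            gcongr
            exact hS n
        _ = 1 / 2 * R := by field_simp
        _ ≤ _ := by
            gcongr
            linarith
    ratio_le := hratio }

/-! ### The two dimensions of the sparse system -/

section Dimension

variable {X : Set (Euc d)} (hX : Convex ℝ X) {z : Euc d} {R D : ℝ} (hR : 0 < R) (hRD : R ≤ D)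
    (hz : Metric.closedBall z R ⊆ X) (hD : ∀ x ∈ X, ∀ y ∈ X, ‖x - y‖ ≤ D)
    (hm : Real.log (2 * D / (R / (2 * d))) ≤
      P.m * (d * Real.log 2) * (1 / t₂ - 1 / d) / 2)

theorem count_gridData (n : ℕ) :
    ((P.gridData hX hR hRD hz hD hm).count n : ℝ) = Real.exp (P.S n) := by
  rw [GridData.count, S, Real.exp_sum]
  push_cast
  refine Finset.prod_congr rfl fun j _ => ?_
  rw [Real.exp_nat_mul, Real.exp_log (by exact_mod_cast P.M_pos j)]
  rfl

theorem ratio_gridData (n : ℕ) :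
    (P.gridData hX hR hRD hz hD hm).ratio n = Real.exp (-P.W n) := by
  rw [GridData.ratio, W, ← Finset.sum_neg_distrib, Real.exp_sum]
  rfl

theorem clusterSize_gridData (n : ℕ) : (P.gridData hX hR hRD hz hD hm).clusterSize n =
    R / (2 * d) * Real.exp (-P.W n - (1 / t₁ - 1 / t₂) * P.S n) := by
  have hM : (P.M n : ℝ) ≠ 0 := by exact_mod_cast (P.M_pos n).ne'
  rw [GridData.clusterSize, ratio_gridData]
  show Real.exp (-P.W n) * (R / (2 * d) * Real.exp (-(1 / t₁ - 1 / t₂) * P.S n) / P.M n) * P.M n = _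
  rw [mul_assoc, div_mul_cancel₀ _ hM, sub_eq_add_neg (-P.W n), ← neg_mul, Real.exp_add]
  ring

theorem tendsto_clusterSize_gridData :
    Tendsto (fun k => (P.gridData hX hR hRD hz hD hm).clusterSize (P.stage k)) atTop (𝓝 0) := by
  have h1 : Tendsto (fun n : ℕ => R / (2 * d) * Real.exp (-(P.rho * n))) atTop (𝓝 0) := by
    rw [← mul_zero (R / (2 * d))]
    refine (Real.tendsto_exp_neg_atTop_nhds_zero.comp ?_).const_mul _
    exact tendsto_natCast_atTop_atTop.const_mul_atTop P.rho_pos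
  refine squeeze_zero (fun k => (GridData.clusterSize_pos _ _).le) (fun k => ?_)
    (h1.comp P.stage_strictMono.tendsto_atTop)
  rw [clusterSize_gridData, Function.comp_apply]
  have h2 := P.le_W (P.stage k)
  have h3 := mul_nonneg P.gap_pos'.le (P.S_nonneg (P.stage k))
  have hd : (0 : ℝ) < d := by exact_mod_cast P.d_pos
  gcongr
  linarith

theorem count_mul_clusterSize_rpow (k : ℕ) :
    (P.gridData hX hR hRD hz hD hm).count (P.stage k) *
      (P.gridData hX hR hRD hz hD hm).clusterSize (P.stage k) ^ t₁ =
      (R / (2 * d) * Real.exp (-(P.rho * P.stage 0))) ^ t₁ := by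
  have hd : (0 : ℝ) < d := by exact_mod_cast P.d_pos
  have hW := P.W_stage k
  have ht1 := P.t₁_pos
  have ht2 := P.t₂_pos
  have e : -P.W (P.stage k) - (1 / t₁ - 1 / t₂) * P.S (P.stage k) =
      -(P.rho * P.stage 0) - P.S (P.stage k) / t₁ := by
    rw [← hW]
    field_simp
    ring
  rw [count_gridData, clusterSize_gridData, e, sub_eq_add_neg, Real.exp_add, ← mul_assoc,
    Real.mul_rpow (by positivity) (Real.exp_pos _).le, ← Real.exp_mul, mul_left_comm,
    ← Real.exp_add, neg_mul, div_mul_cancel₀ _ ht1.ne', add_neg_cancel, Real.exp_zero, mul_one]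

theorem dimH_limitSet_gridData [Nontrivial (Euc d)] (hXc : IsCompact X) :
    dimH (P.gridData hX hR hRD hz hD hm).system.limitSet = ENNReal.ofReal t₁ := by
  have hd : (0 : ℝ) < d := by exact_mod_cast P.d_pos
  have hB := P.count_mul_clusterSize_rpow hX hR hRD hz hD hm
  set c := (R / (2 * d) * Real.exp (-(P.rho * P.stage 0))) ^ t₁ with hc
  have hc0 : 0 < c := by positivity
  have ht : (t₁.toNNReal : ℝ) = t₁ := Real.coe_toNNReal _ P.t₁_pos.le
  apply le_antisymm
  · refine GridData.dimH_limitSet_le _ P.one_lt_M_stage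
      (P.tendsto_clusterSize_gridData hX hR hRD hz hD hm) (C := c) fun k => ?_
    rw [ht, hB]
  · refine GridData.le_dimH_limitSet _ P.d_pos hXc ?_ P.stage_strictMono P.one_lt_M_stage
      (fun k j h1 h2 => P.M_of_notMem (P.notMem_range_stage h1 h2))
      (P.tendsto_clusterSize_gridData hX hR hRD hz hD hm) (C := c⁻¹) (by positivity) fun k => ?_
    · rw [ht]
      exact (P.t₁_lt.trans P.t₂_lt).le
    · rw [ht, hB, inv_mul_cancel₀ hc0.ne']

theorem Z_gridData [Nontrivial (Euc d)] (n : ℕ) (t : ℝ≥0) :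
    (P.gridData hX hR hRD hz hD hm).system.Z n t =
      ENNReal.ofReal (Real.exp (P.S n - t * P.W n)) := by
  rw [GridData.Z_eq, count_gridData, ratio_gridData, ← Real.exp_mul, ← Real.exp_add]
  congr 2
  ring

/-- For `t > t₂` the sums `Z` are at most `1` along the branching stages; for `t < t₂`, `le_S`
leaves an exponent of at least `(t₂ - t) * rho * n` minus a constant. -/
theorem bowenDim_gridData [Nontrivial (Euc d)] :
    (P.gridData hX hR hRD hz hD hm).system.bowenDim = ENNReal.ofReal t₂ := by
  have hρ := P.rho_pos
  apply le_antisymm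
  · refine iSup₂_le fun t ht => ?_
    by_contra! hlt
    have hlt : t₂ < t := (Real.toNNReal_lt_iff_lt_coe P.t₂_pos.le).1 (ENNReal.coe_lt_coe.1 hlt)
    refine ht.not_ge ?_
    refine liminf_le_of_frequently_le ?_
    refine Tendsto.frequently P.stage_strictMono.tendsto_atTop (Frequently.of_forall fun k => ?_)
    have hneg : P.S (P.stage k) - t * P.W (P.stage k) ≤ 0 := by
      rw [← P.W_stage]
      have h1 := P.le_W (P.stage k)
      have h2 : 0 ≤ P.rho * P.stage k := by positivity
      have h3 : 0 ≤ t₂ * (P.rho * P.stage 0) := by have := P.t₂_pos; positivity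
      nlinarith
    rw [Z_gridData, ENNReal.log_ofReal_exp]
    have h : (((P.S (P.stage k) - t * P.W (P.stage k) : ℝ)) : EReal) ≤ 0 := by exact_mod_cast hneg
    exact EReal.div_nonpos_of_nonpos_of_nonneg h (by positivity)
  · refine ENNReal.le_of_forall_nnreal_lt fun t ht => ?_
    have ht : (t : ℝ) < t₂ := by
      exact Real.lt_toNNReal_iff_coe_lt.1 (ENNReal.coe_lt_coe.1 ht)
    refine le_iSup₂ (f := fun (t : ℝ≥0) (_ : 0 <
      (P.gridData hX hR hRD hz hD hm).system.lowerPressure t) => (t : ℝ≥0∞)) t ?_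
    -- Half of the exponential rate; the other half absorbs the constant.
    set c := (t₂ - t) * P.rho / 2 with hc
    have hc0 : 0 < c := half_pos (mul_pos (sub_pos.2 ht) hρ)
    refine lt_of_lt_of_le (b := (c : EReal)) (by exact_mod_cast hc0) ?_
    refine le_liminf_of_le (by isBoundedDefault) ?_
    have hev : ∀ᶠ n : ℕ in atTop, t₂ * (P.rho * P.stage 0) < c * n :=
      (tendsto_natCast_atTop_atTop.const_mul_atTop hc0).eventually_gt_atTop _
    filter_upwards [hev, eventually_gt_atTop 0] with n hn hn0
    refine ((ENNReal.lt_log_div_natCast_iff hn0 c).2 ?_).le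
    rw [Z_gridData, ENNReal.ofReal_lt_ofReal_iff (Real.exp_pos _), Real.exp_lt_exp]
    have h1 := P.le_S n
    have h2 := mul_le_mul_of_nonneg_left (P.le_W n) (sub_pos.2 ht).le
    have e : c * n + c * n = (t₂ - t) * (P.rho * n) := by rw [hc]; ring
    linarith

theorem growth_gridData_le (n : ℕ) :
    (P.gridData hX hR hRD hz hD hm).system.growth n ≤ P.rate := by
  have hcard : Nat.card ((P.gridData hX hR hRD hz hD hm).system.I n) = P.M n ^ d := by
    show Nat.card (Fin d → Fin (P.M n)) = P.M n ^ d
    simp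
  rw [NCIFS.growth, hcard, div_le_iff₀ (by positivity)]
  push_cast
  rw [Real.log_pow]
  have h1 := P.rate_pos
  by_cases h : n ∈ range P.stage
  · obtain ⟨k, rfl⟩ := h
    rw [log_M_stage]
    gcongr
    linarith
  · rw [P.M_of_notMem h]
    simp only [Nat.cast_one, Real.log_one, mul_zero]
    positivity

end Dimension

end SparseData

/-! ### Conclusion -/

theorem exists_perfectlyBalanced {d : ℕ} (hd : 0 < d) [Nontrivial (Euc d)] {X : Set (Euc d)}
    (hX : IsPhaseSpace X) (hconv : Convex ℝ X) {t₁ t₂ ε : ℝ} (h0 : 0 < t₁) (h1 : t₁ < t₂)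
    (h2 : t₂ < d) (hε : 0 < ε) :
    ∃ Φ : NCIFS X, Φ.IsFinite ∧ Φ.PerfectlyBalanced ∧
      limsup (fun n => (Φ.growth n : EReal)) atTop ≤ (ε : EReal) ∧
      dimH Φ.limitSet = ENNReal.ofReal t₁ ∧ Φ.bowenDim = ENNReal.ofReal t₂ := by
  obtain ⟨z, hz⟩ := hX.interior_nonempty
  obtain ⟨R', hR', hRX⟩ := Metric.isOpen_iff.1 isOpen_interior z hz
  have hball : Metric.closedBall z (R' / 2) ⊆ X :=
    (Metric.closedBall_subset_ball (by linarith)).trans (hRX.trans interior_subset)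
  obtain ⟨D', hD'⟩ := Metric.isBounded_iff.1 hX.isCompact.isBounded
  set R := R' / 2 with hR
  have hR0 : 0 < R := by positivity
  set D := max D' R with hD
  have hDX : ∀ x ∈ X, ∀ y ∈ X, ‖x - y‖ ≤ D := fun x hx y hy => by
    rw [← dist_eq_norm]
    exact (hD' hx hy).trans (le_max_left _ _)
  have hd' : (0 : ℝ) < d := by exact_mod_cast hd
  have ht2 : 0 < t₂ := h0.trans h1
  have hgap : 0 < 1 / t₂ - 1 / (d : ℝ) := sub_pos.2 (one_div_lt_one_div_of_lt ht2 h2)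
  have hlog := Real.log_pos one_lt_two
  -- `q` makes the growth rate `d log 2 / q` at most `ε`, `l` makes past branchings negligible, and
  -- `m` starts the branching late enough to absorb the geometry of `X`.
  obtain ⟨q, hq⟩ := exists_nat_gt (d * Real.log 2 / ε)
  have hq0 : (0 : ℝ) < q := lt_trans (by positivity) hq
  obtain ⟨l, hl⟩ := exists_nat_gt (4 * (1 / t₁ - 1 / t₂) / (1 / t₂ - 1 / d))
  obtain ⟨m, hm⟩ := exists_nat_gt
    (Real.log (2 * D / (R / (2 * d))) / (d * Real.log 2 * (1 / t₂ - 1 / d) / 2))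
  let P : SparseData d t₁ t₂ :=
    { q := q
      m := m + 1
      l := l + 2
      d_pos := hd
      q_pos := by exact_mod_cast hq0
      m_pos := m.succ_pos
      two_le_l := by omega
      t₁_pos := h0
      t₁_lt := h1
      t₂_lt := h2
      gap_le := by
        rw [div_lt_iff₀ hgap] at hl
        push_cast
        linarith }
  have hPm : Real.log (2 * D / (R / (2 * d))) ≤
      P.m * (d * Real.log 2) * (1 / t₂ - 1 / d) / 2 := by
    have hpos : 0 < d * Real.log 2 * (1 / t₂ - 1 / d) / 2 := by positivity
    rw [div_lt_iff₀ hpos] at hm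
    show _ ≤ ((m + 1 : ℕ) : ℝ) * (d * Real.log 2) * (1 / t₂ - 1 / d) / 2
    push_cast
    linarith
  refine ⟨(P.gridData hconv hR0 (le_max_right _ _) hball hDX hPm).system,
    GridData.system_isFinite _, GridData.system_perfectlyBalanced _, ?_,
    P.dimH_limitSet_gridData hconv hR0 _ hball hDX hPm hX.isCompact,
    P.bowenDim_gridData hconv hR0 _ hball hDX hPm⟩
  refine limsup_le_of_le (by isBoundedDefault) (Eventually.of_forall fun n => ?_)
  have hrate : P.rate ≤ ε := by
    show d * Real.log 2 / (q : ℝ) ≤ ε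
    rw [div_lt_iff₀ hε] at hq
    rw [div_le_iff₀ hq0]
    linarith
  exact_mod_cast (P.growth_gridData_le hconv hR0 _ hball hDX hPm n).trans hrate

end

theorem theorem1p1 (d : ℕ) (hd : 0 < d) (X : Set (Euc d)) (hX : IsPhaseSpace X) :
    (∀ Φ : NCIFS X, Φ.IsFinite → Tendsto Φ.growth atTop (𝓝 0) →
      dimH Φ.limitSet = Φ.bowenDim) ∧
    (Convex ℝ X → ∀ t₁ t₂ ε : ℝ, 0 < t₁ → t₁ < t₂ → t₂ < d → 0 < ε →
      ∃ Φ : NCIFS X, Φ.IsFinite ∧ Φ.PerfectlyBalanced ∧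
        limsup (fun n => (Φ.growth n : EReal)) atTop ≤ (ε : EReal) ∧
        dimH Φ.limitSet = ENNReal.ofReal t₁ ∧ Φ.bowenDim = ENNReal.ofReal t₂) := by
  have : Nonempty (Fin d) := ⟨⟨0, hd⟩⟩
  have : Nontrivial (Euc d) := inferInstance
  exact ⟨fun Φ hΦ hg => le_antisymm (Φ.dimH_limitSet_le_bowenDim hX hΦ)
      (Φ.bowenDim_le_dimH_limitSet hd hX hΦ hg),
    fun hconv t₁ t₂ ε h0 h1 h2 hε => exists_perfectlyBalanced hd hX hconv h0 h1 h2 hε⟩
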